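/- A *partial group* is a simplicial set $M$ with exactly one vertex such that, for every $n\ge 1$, the spine operator $M_n\to (M_1)^n$ (sending a simplex to its edges $x_1,\dots,x_n$ joining consecutive vertices; the simplex is then written $[x_1|\dots|x_n]$) is injective, and which has an *inversion*: a simplicial map $\nu\colon M\to M^{\mathrm{op}}$ with $\nu\circ\nu=\mathrm{id}$ such that for each simplex $u\in M_n$, $n\ge 1$, there is a simplex $[\nu(u)|u]\in M_{2n}$ (with front $n$-face $\nu(u)$ and back $n$-face $u$) whose product is the unit. Here the product $x_1\cdots x_n\in M_1$ of $[x_1|\dots|x_n]$ is the edge from its first to its last vertex, and the unit $1\in M_1$ is the degenerate edge. For a partial group $M$ let * $\operatorname{aut}(M)$ be the simplicial group of invertible elements of the simplicial monoid $\operatorname{Map}(M,M)$, whose $n$-simplices are the simplicial maps $M\times\Delta[n]\to M$, with product $(fg)(x,t)=f(g(x,t),t)$; so $\operatorname{aut}(M)_0=\operatorname{Aut}(M)$; * $\operatorname{Out}(M)=\operatorname{Aut}(M)/\operatorname{Inn}(M)$, where $\operatorname{Inn}(M)$ is the normal subgroup of the automorphisms that are homotopic to the identity; equivalently, $\operatorname{Out}(M)$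 is the group of homotopy classes of automorphisms of $M$; * $Z(M)\subseteq M_1$ be the set of the elements $\eta$ of the form $\eta=F(1,\iota)$, where $F\colon M\times\Delta[1]\to M$ is a homotopy from $\mathrm{id}_M$ to $\mathrm{id}_M$ and $\iota$ is the nondegenerate edge of $\Delta[1]$; it is an abelian group under the product of $M$. For a simplicial group $G$ let $BG$ be its classifying space, the diagonal of the levelwise bar construction, with base point its unique vertex. A discrete group is regarded as a constant simplicial group. For an abelian group $A$ the bar construction $BA$ is itself a simplicial group, and $B^2A=B(BA)$. **Corollary.** Let $M$ be a partial group. Let $q\colon\operatorname{aut}(M)\to\operatorname{Out}(M)$ be the homomorphism that sends a simplex to the class of any of its vertices. There is a homomorphism of simplicial groups $j\colon BZ(M)\to\operatorname{aut}(M)$ that sends each $1$-simplex $[\eta]$ to a simplex $F\colon M\times\Delta[1]\to M$ with $F(1,\iota)=\eta$, such that $$B^2Z(M)\xrightarrow{\;Bj\;}B\operatorname{aut}(M)\xrightarrow{\;Bq\;}B\operatorname{Out}(M)$$ is a fibration sequence: $Bq$ is a Kan fibration, $B\operatorname{Out}(M)$ and $B^2Z(M)$ are Kan complexes, and $Bj$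 factors through a weak equivalence from $B^2Z(M)$ to the fibre of $Bq$ over the base point. Moreover, $\operatorname{aut}(M)$ is a Kan complex; sending an automorphism to its class induces an isomorphism of groups $\pi_0(\operatorname{aut}(M))\cong\operatorname{Out}(M)$; and for every vertex $\alpha$ of $\operatorname{aut}(M)$ there is an isomorphism of groups $\pi_1(\operatorname{aut}(M),\alpha)\cong Z(M)$, and $\pi_n(\operatorname{aut}(M),\alpha)=0$ for all $n\ge 2$. -/

import Mathlib

open CategoryTheory Simplicial MonoidalCategory CartesianMonoidalCategory Opposite

universe u

namespace PGrp

/-- The `n`-simplices of the function complex `Map(X, X)`: simplicial maps `X × Δ[n] ⟶ X`. -/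
abbrev EndSimplex (X : SSet.{u}) (n : SimplexCategory) : Type u :=
  X ⊗ SSet.stdSimplex.obj n ⟶ X

namespace EndSimplex

variable {X : SSet.{u}} {n m : SimplexCategory}

/-- The product of `f` and `g` is `f ∘ (g, pr₂)`, i.e. `(f * g)(x, t) = f (g (x, t), t)`;
the unit is the projection to `X`. -/
instance : Monoid (EndSimplex X n) where
  mul f g := lift g (snd _ _) ≫ f
  one := fst _ _
  mul_assoc f g h := by
    change lift h (snd _ _) ≫ lift g (snd _ _) ≫ f = lift (lift h (snd _ _) ≫ g) (snd _ _) ≫ f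
    rw [← Category.assoc]
    congr 1
  one_mul f := by
    change lift f (snd _ _) ≫ fst _ _ = f
    simp
  mul_one f := by
    change lift (fst _ _) (snd _ _) ≫ f = f
    simp

lemma mul_def (f g : EndSimplex X n) : f * g = lift g (snd _ _) ≫ f := rfl
lemma one_def : (1 : EndSimplex X n) = fst _ _ := rfl

/-- The simplicial operators of `Map(X, X)`: restriction along `Δ[m] ⟶ Δ[n]`. -/
def restrict (θ : m ⟶ n) : EndSimplex X n →* EndSimplex X m where
  toFun f := X ◁ SSet.stdSimplex.map θ ≫ f
  map_one' := by rw [one_def, one_def]; simp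
  map_mul' f g := by
    rw [mul_def, mul_def, ← Category.assoc, ← Category.assoc]
    congr 1

/-- Restriction of `f : X × Δ[n] ⟶ X` to the `i`-th vertex, an endomorphism of `X`. In `End X`
the product `f * g` is the composite `f ∘ g`. -/
def atVertex (i : Fin (n.len + 1)) : EndSimplex X n →* End X where
  toFun f := lift (𝟙 X) (SSet.const (SSet.stdSimplex.objEquiv.symm
    (SimplexCategory.const ⦋0⦌ n i))) ≫ f
  map_one' := rfl
  map_mul' _ _ := rfl

end EndSimplex

/-- The automorphism complex of `X`: the simplicial group of invertible elements of the simplicial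
monoid `Map(X, X)`. -/
def aut (X : SSet.{u}) : SimplicialObject GrpCat.{u} where
  obj n := GrpCat.of (EndSimplex X n.unop)ˣ
  map θ := GrpCat.ofHom (Units.map (EndSimplex.restrict θ.unop))
  map_id n := by
    refine GrpCat.ext fun f => Units.ext ?_
    change X ◁ SSet.stdSimplex.map (𝟙 _) ≫ f.val = f.val
    exact (congrArg (X ◁ · ≫ f.val) (CategoryTheory.Functor.map_id SSet.stdSimplex _)).trans rfl
  map_comp θ ψ := by
    refine GrpCat.ext fun f => Units.ext ?_
    change X ◁ SSet.stdSimplex.map (ψ.unop ≫ θ.unop) ≫ f.val =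
      X ◁ SSet.stdSimplex.map ψ.unop ≫ X ◁ SSet.stdSimplex.map θ.unop ≫ f.val
    exact (congrArg (X ◁ · ≫ f.val)
      (CategoryTheory.Functor.map_comp SSet.stdSimplex ψ.unop θ.unop)).trans rfl

/-- The automorphism of `X` obtained from an `n`-simplex of `aut X` by restriction to the `i`-th
vertex. -/
def autAtVertex (X : SSet.{u}) {n : SimplexCategory} (i : Fin (n.len + 1)) :
    (aut X).obj (op n) →* Aut X :=
  (Aut.unitsEndEquivAut X).toMonoidHom.comp (Units.map (EndSimplex.atVertex i))

/-- The vertices of `aut X` are the automorphisms of `X`. -/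
noncomputable def autZeroEquiv (X : SSet.{u}) : (aut X).obj (op ⦋0⦌) ≃* Aut X :=
  MulEquiv.ofBijective (autAtVertex X (n := ⦋0⦌) 0) (by
    have key : ∀ f : EndSimplex X ⦋0⦌, fst _ _ ≫ EndSimplex.atVertex 0 f = f := by
      intro f
      change fst _ _ ≫ lift (𝟙 X) _ ≫ f = f
      rw [← Category.assoc]
      convert Category.id_comp f
      apply CartesianMonoidalCategory.hom_ext
      · simp
      · exact SSet.stdSimplex.isTerminalObj₀.hom_ext _ _
    constructor
    · intro f g h
      apply Units.ext
      rw [← key f.val, ← key g.val]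
      congr 1
      exact congr($(h).hom)
    · intro a
      refine ⟨⟨fst _ _ ≫ a.hom, fst _ _ ≫ a.inv, ?_, ?_⟩, ?_⟩
      · change lift (fst _ _ ≫ a.inv) (snd _ _) ≫ fst _ _ ≫ a.hom = fst _ _
        rw [lift_fst_assoc, Category.assoc, a.inv_hom_id, Category.comp_id]
      · change lift (fst _ _ ≫ a.hom) (snd _ _) ≫ fst _ _ ≫ a.inv = fst _ _
        rw [lift_fst_assoc, Category.assoc, a.hom_inv_id, Category.comp_id]
      · ext1
        rfl)

/-- An `n`-simplex `[g₁|…|gₙ]` of the bar construction of a group `G`, recorded through all its edges: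
`toFun i j` is `gᵢ₊₁ ⋯ gⱼ` if `i ≤ j`, and the inverse of `gⱼ₊₁ ⋯ gᵢ` if `j ≤ i`; so `gᵢ` is
`toFun (i-1) i`, see `BarSimplex.spineEquiv`. With this description the simplicial operators are
restrictions along monotone maps; e.g. an inner face `d_i` replaces `gᵢ, gᵢ₊₁` by `gᵢ gᵢ₊₁`. -/
structure BarSimplex (G : Type u) [Group G] (n : ℕ) where
  toFun : Fin (n + 1) → Fin (n + 1) → G
  cocycle : ∀ i j k, toFun i j * toFun j k = toFun i k

namespace BarSimplex

lemma ext {G : Type u} [Group G] {n : ℕ} {c d : BarSimplex G n}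
    (h : ∀ i j, c.toFun i j = d.toFun i j) : c = d := by
  cases c; cases d; congr; funext i j; exact h i j

/-- A simplex of the bar construction is given by an arbitrary `n`-tuple of group elements. -/
def spineEquiv {G : Type u} [Group G] {n : ℕ} : BarSimplex G n ≃ (Fin n → G) where
  toFun c i := c.toFun i.castSucc i.succ
  invFun g :=
    { toFun := fun i j => ((List.ofFn g).take i).prod⁻¹ * ((List.ofFn g).take j).prod
      cocycle := fun i j k => by group }
  left_inv c := by
    have key : ∀ (j : ℕ) (hj : j < n + 1),
        ((List.ofFn (fun i : Fin n => c.toFun i.castSucc i.succ)).take j).prod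
          = c.toFun 0 ⟨j, hj⟩ := by
      intro j
      induction j with
      | zero =>
        intro hj
        have h : c.toFun 0 0 = 1 := by simpa using c.cocycle 0 0 0
        simpa using h.symm
      | succ j ih =>
        intro hj
        rw [List.prod_take_succ _ _ (by simpa using hj), ih (by omega)]
        simpa using c.cocycle 0 ⟨j, by omega⟩ ⟨j + 1, hj⟩
    refine ext fun i j => ?_
    change (List.prod _)⁻¹ * List.prod _ = _
    rw [key i i.2, key j j.2]
    simp [inv_mul_eq_iff_eq_mul, c.cocycle]
  right_inv g := by
    funext i
    simp only [Fin.val_succ, Fin.val_castSucc]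
    rw [List.prod_take_succ _ _ (by simp)]
    simp

end BarSimplex

/-- The classifying space `B G` of a simplicial group `G`: the diagonal of the levelwise bar
construction, so `(B G)_n = B_n (G_n)`. -/
def bar (G : SimplicialObject GrpCat.{u}) : SSet.{u} where
  obj n := BarSimplex (G.obj n) n.unop.len
  map {n m} θ := ↾fun c =>
    { toFun := fun i j => G.map θ (c.toFun (θ.unop.toOrderHom i) (θ.unop.toOrderHom j))
      cocycle := fun i j k => by rw [← map_mul, c.cocycle] }
  map_id n := by
    refine ConcreteCategory.hom_ext _ _ fun c => BarSimplex.ext fun i j => ?_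
    exact congr($(G.map_id n) (c.toFun i j))
  map_comp θ ψ := by
    refine ConcreteCategory.hom_ext _ _ fun c => BarSimplex.ext fun i j => ?_
    exact congr($(G.map_comp θ ψ) (c.toFun _ _))

/-- The map of classifying spaces induced by a homomorphism of simplicial groups. -/
def bar.map {G H : SimplicialObject GrpCat.{u}} (f : G ⟶ H) : bar G ⟶ bar H where
  app n := ↾fun c =>
    { toFun := fun i j => f.app n (c.toFun i j)
      cocycle := fun i j k => by rw [← map_mul, c.cocycle] }
  naturality n m θ := by
    refine ConcreteCategory.hom_ext _ _ fun c => BarSimplex.ext fun i j => ?_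
    exact congr($(f.naturality θ) (c.toFun (θ.unop.toOrderHom i) (θ.unop.toOrderHom j)))

/-- The unique vertex of `B G`. -/
def bar.vertex (G : SimplicialObject GrpCat.{u}) : (bar G) _⦋0⦌ :=
  ⟨fun _ _ => 1, fun _ _ _ => one_mul _⟩

/-- A discrete group as a (constant) simplicial group; `bar (constGroup G)` is the usual bar
construction of `G`. -/
def constGroup (G : Type u) [Group G] : SimplicialObject GrpCat.{u} :=
  (Functor.const _).obj (GrpCat.of G)

namespace BarSimplex

/-- For an abelian group, the simplices of the bar construction multiply edgewise. -/
instance commGroup (A : Type u) [CommGroup A] (n : ℕ) : CommGroup (BarSimplex A n) where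
  mul c d := ⟨fun i j => c.toFun i j * d.toFun i j, fun i j k => by
    rw [← c.cocycle i j k, ← d.cocycle i j k]; exact mul_mul_mul_comm _ _ _ _⟩
  one := ⟨fun _ _ => 1, fun _ _ _ => one_mul _⟩
  inv c := ⟨fun i j => (c.toFun i j)⁻¹, fun i j k => by rw [← c.cocycle i j k, mul_inv]⟩
  mul_assoc _ _ _ := ext fun _ _ => mul_assoc _ _ _
  one_mul _ := ext fun _ _ => one_mul _
  mul_one _ := ext fun _ _ => mul_one _
  inv_mul_cancel _ := ext fun _ _ => inv_mul_cancel _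
  mul_comm _ _ := ext fun _ _ => mul_comm _ _

end BarSimplex

/-- For an abelian group `A`, the bar construction `B A` as a simplicial group. Its classifying space
`bar (barGroup A)` is `B² A`. -/
def barGroup (A : Type u) [CommGroup A] : SimplicialObject GrpCat.{u} where
  obj n := GrpCat.of (BarSimplex A n.unop.len)
  map θ := GrpCat.ofHom
    { toFun := fun c => ⟨fun i j => c.toFun (θ.unop.toOrderHom i) (θ.unop.toOrderHom j),
        fun _ _ _ => c.cocycle _ _ _⟩
      map_one' := rfl
      map_mul' := fun _ _ => rfl }
  map_id _ := rfl
  map_comp _ _ := rfl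

/-- The simplicial set underlying a simplicial group. -/
abbrev under (G : SimplicialObject GrpCat.{u}) : SSet.{u} := G ⋙ forget GrpCat

section PartialGroups

variable {M : SSet.{u}}

/-- The `i`-th edge of a simplex `[x₁|…|xₙ]` (indices start at `0`). -/
def edge {n : ℕ} (i : Fin n) (x : M _⦋n⦌) : M _⦋1⦌ := M.map (SimplexCategory.mkOfSucc i).op x

/-- The product (back edge) `x₁ ⋯ xₙ` of a simplex `[x₁|…|xₙ]`. -/
def product {n : ℕ} (x : M _⦋n⦌) : M _⦋1⦌ := M.map (SimplexCategory.diag n).op x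

/-- A partial monoid: a reduced simplicial set all of whose spine operators are injective. -/
class IsPartialMonoid (M : SSet.{u}) : Prop where
  nonempty : Nonempty (M _⦋0⦌)
  subsingleton : Subsingleton (M _⦋0⦌)
  spine_injective : ∀ n : ℕ, 1 ≤ n → Function.Injective fun (x : M _⦋n⦌) (i : Fin n) => edge i x

/-- The unique vertex of a partial monoid. -/
noncomputable def vertex (M : SSet.{u}) [IsPartialMonoid M] : M _⦋0⦌ :=
  (IsPartialMonoid.nonempty (M := M)).some

/-- The unit `1`, the degeneracy of the vertex. -/
noncomputable def unit (M : SSet.{u}) [IsPartialMonoid M] : M _⦋1⦌ := M.σ 0 (vertex M)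

/-- A simplicial map `ν : M ⟶ Mᵒᵖ` as a map from the simplices of `M` to the simplices of `M`. -/
def opApply (ν : M ⟶ M.op) {n : SimplexCategoryᵒᵖ} (x : M.obj n) : M.obj n :=
  SSet.opObjEquiv (ν.app n x)

/-- An inversion of a partial monoid: an anti-involution `ν` such that for each simplex `u` of
dimension `n ≥ 1` there is a `2n`-simplex `w = [ν(u)|u]` (its front and back `n`-faces are `ν(u)` and
`u`, which determines `w`), with product `1`. -/
structure IsInversion [IsPartialMonoid M] (ν : M ⟶ M.op) : Prop where
  involutive : ∀ (n : SimplexCategoryᵒᵖ) (x : M.obj n), opApply ν (opApply ν x) = x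
  exists_simplex : ∀ (n : ℕ), 1 ≤ n → ∀ u : M _⦋n⦌, ∃ w : M _⦋n + n⦌,
    M.map (SimplexCategory.subinterval 0 n (by omega)).op w = opApply ν u ∧
    M.map (SimplexCategory.subinterval n n le_rfl).op w = u ∧
    product w = unit M

/-- A partial group: a partial monoid that has an inversion (which is then unique). -/
class IsPartialGroup (M : SSet.{u}) : Prop extends IsPartialMonoid M where
  exists_inversion : ∃ ν : M ⟶ M.op, IsInversion ν


lemma app_map {X Y : SSet.{u}} (f : X ⟶ Y) {n m : SimplexCategoryᵒᵖ} (θ : n ⟶ m) (x : X.obj n) :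
    f.app m (X.map θ x) = Y.map θ (f.app n x) := NatTrans.naturality_apply f θ x

lemma hom_ext_one [IsPartialMonoid M] {X : SSet.{u}} {f g : X ⟶ M}
    (h : ∀ x : X _⦋1⦌, f.app _ x = g.app _ x) : f = g := by
  ext ⟨n⟩ x
  induction n using SimplexCategory.rec with | _ n
  obtain _ | n := n
  · exact (IsPartialMonoid.subsingleton (M := M)).elim _ _
  · apply IsPartialMonoid.spine_injective (n + 1) (by omega)
    funext i
    exact (app_map f _ x).symm.trans ((h _).trans (app_map g _ x))

lemma triangle_ext [IsPartialMonoid M] {w w' : M _⦋2⦌} (h₂ : M.δ 2 w = M.δ 2 w')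
    (h₀ : M.δ 0 w = M.δ 0 w') : w = w' := by
  apply IsPartialMonoid.spine_injective 2 (by omega)
  funext i
  fin_cases i
  · change M.map (SimplexCategory.mkOfSucc (0 : Fin 2)).op w =
      M.map (SimplexCategory.mkOfSucc (0 : Fin 2)).op w'
    rw [SimplexCategory.mkOfSucc_zero_eq_δ]
    exact h₂
  · change M.map (SimplexCategory.mkOfSucc (1 : Fin 2)).op w =
      M.map (SimplexCategory.mkOfSucc (1 : Fin 2)).op w'
    rw [SimplexCategory.mkOfSucc_one_eq_δ]
    exact h₀

lemma vertex_eq [IsPartialMonoid M] (v w : M _⦋0⦌) : v = w :=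
  (IsPartialMonoid.subsingleton (M := M)).elim _ _

lemma opApply_map (ν : M ⟶ M.op) {n m : SimplexCategoryᵒᵖ} (θ : n ⟶ m) (x : M.obj n) :
    opApply ν (M.map θ x) = M.map (SimplexCategory.rev.map θ.unop).op (opApply ν x) := by
  unfold opApply
  rw [app_map, SSet.op_map]
  rfl

lemma map_map {X : SSet.{u}} {n m k : SimplexCategory} (θ : n ⟶ m) (ψ : m ⟶ k)
    (x : X.obj (op k)) : X.map θ.op (X.map ψ.op x) = X.map (θ ≫ ψ).op x := by
  rw [op_comp, Functor.map_comp_apply]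

lemma map_id_op {X : SSet.{u}} {n : SimplexCategory} (x : X.obj (op n)) :
    X.map (𝟙 n).op x = x := by simp

lemma map_congr {X : SSet.{u}} {n m : SimplexCategory} {θ ψ : n ⟶ m} (h : θ = ψ)
    (x : X.obj (op m)) : X.map θ.op x = X.map ψ.op x := by rw [h]

lemma mul_one_aux [IsPartialMonoid M] (w : M _⦋2⦌) (h : M.δ 0 w = unit M) :
    M.δ 1 w = M.δ 2 w := by
  have : w = M.σ 1 (M.δ 2 w) := by
    apply triangle_ext
    · exact ((map_map _ _ _).trans ((map_congr (ψ := 𝟙 _) (by decide) _).trans (map_id_op _))).symm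
    · rw [h]
      refine Eq.trans ?_ ((map_map _ _ _).trans (map_congr (ψ := SimplexCategory.σ 0 ≫
        SimplexCategory.δ 0) (by decide) _)).symm
      refine Eq.trans ?_ (map_map _ _ _)
      exact congrArg _ (vertex_eq _ _)
  conv_lhs => rw [this]
  exact (map_map _ _ _).trans ((map_congr (ψ := 𝟙 _) (by decide) _).trans (map_id_op _))

lemma one_mul_aux [IsPartialMonoid M] (w : M _⦋2⦌) (h : M.δ 2 w = unit M) :
    M.δ 1 w = M.δ 0 w := by
  have : w = M.σ 0 (M.δ 0 w) := by
    apply triangle_ext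
    · rw [h]
      refine Eq.trans ?_ ((map_map _ _ _).trans (map_congr (ψ := SimplexCategory.σ 0 ≫
        SimplexCategory.δ 1) (by decide) _)).symm
      refine Eq.trans ?_ (map_map _ _ _)
      exact congrArg _ (vertex_eq _ _)
    · exact ((map_map _ _ _).trans ((map_congr (ψ := 𝟙 _) (by decide) _).trans (map_id_op _))).symm
  conv_lhs => rw [this]
  exact (map_map _ _ _).trans ((map_congr (ψ := 𝟙 _) (by decide) _).trans (map_id_op _))

lemma IsInversion.exists_triangle [IsPartialMonoid M] {ν : M ⟶ M.op} (hν : IsInversion ν)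
    (x : M _⦋1⦌) : ∃ w : M _⦋2⦌, M.δ 2 w = opApply ν x ∧ M.δ 0 w = x ∧ M.δ 1 w = unit M := by
  obtain ⟨w, h₁, h₂, h₃⟩ := hν.exists_simplex 1 le_rfl x
  refine ⟨w, ?_, ?_, ?_⟩
  · rw [← h₁]; exact map_congr (by decide) _
  · rw [← h₂]; exact map_congr (by decide) _
  · rw [← h₃]; exact map_congr (by decide) _

lemma IsInversion.eq_of_product [IsPartialMonoid M] {ν : M ⟶ M.op} (hν : IsInversion ν)
    (w : M _⦋2⦌) (hw : M.δ 1 w = unit M) : M.δ 2 w = opApply ν (M.δ 0 w) := by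
  obtain ⟨W, h₁, h₂, -⟩ := hν.exists_simplex 2 (by omega) (opApply ν w)
  rw [hν.involutive] at h₁
  obtain ⟨w', h₃, h₄, h₅⟩ := hν.exists_triangle (opApply ν (M.δ 0 w))
  rw [hν.involutive] at h₃
  have e₂₃ : M.map (SimplexCategory.mkOfLe (n := 4) 2 3 (by decide)).op W =
      opApply ν (M.δ 0 w) := by
    refine Eq.trans ?_ (opApply_map ν _ _).symm
    rw [← h₂]
    exact (map_congr (by decide) _).trans (map_map _ _ _).symm
  have e₁₂ : M.map (SimplexCategory.mkOfLe (n := 4) 1 2 (by decide)).op W = M.δ 0 w := by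
    rw [← h₁]
    exact (map_congr (by decide) _).trans (map_map _ _ _).symm
  have e₀₁ : M.map (SimplexCategory.mkOfLe (n := 4) 0 1 (by decide)).op W = M.δ 2 w := by
    rw [← h₁]
    exact (map_congr (by decide) _).trans (map_map _ _ _).symm
  have e₀₂ : M.map (SimplexCategory.mkOfLe (n := 4) 0 2 (by decide)).op W = unit M := by
    rw [← hw, ← h₁]
    exact (map_congr (by decide) _).trans (map_map _ _ _).symm
  have T : M.map (SimplexCategory.mkOfLeComp (n := 4) 1 2 3 (by decide) (by decide)).op W = w' := by
    apply triangle_ext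
    · rw [h₃, ← e₁₂]
      exact (map_map _ _ _).trans (map_congr (by decide) _)
    · rw [h₄, ← e₂₃]
      exact (map_map _ _ _).trans (map_congr (by decide) _)
  have e₁₃ : M.map (SimplexCategory.mkOfLe (n := 4) 1 3 (by decide)).op W = unit M := by
    rw [← h₅, ← T]
    exact (map_congr (by decide) _).trans (map_map _ _ _).symm
  have e₀₃ : M.map (SimplexCategory.mkOfLe (n := 4) 0 3 (by decide)).op W = M.δ 2 w := by
    have := mul_one_aux
      (M.map (SimplexCategory.mkOfLeComp (n := 4) 0 1 3 (by decide) (by decide)).op W)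
      (((map_map _ _ _).trans (map_congr (by decide) _)).trans e₁₃)
    refine Eq.trans (map_congr (by decide) _)
      ((map_map _ _ _).symm.trans (this.trans (Eq.trans ?_ e₀₁)))
    exact (map_map _ _ _).trans (map_congr (by decide) _)
  have e₀₃' : M.map (SimplexCategory.mkOfLe (n := 4) 0 3 (by decide)).op W =
      opApply ν (M.δ 0 w) := by
    have := one_mul_aux
      (M.map (SimplexCategory.mkOfLeComp (n := 4) 0 2 3 (by decide) (by decide)).op W)
      (((map_map _ _ _).trans (map_congr (by decide) _)).trans e₀₂)
    refine Eq.trans (map_congr (by decide) _)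
      ((map_map _ _ _).symm.trans (this.trans (Eq.trans ?_ e₂₃)))
    exact (map_map _ _ _).trans (map_congr (by decide) _)
  rw [← e₀₃, e₀₃']

lemma app_unit [IsPartialMonoid M] (f : M ⟶ M) : f.app _ (unit M) = unit M := by
  refine (app_map f _ _).trans ?_
  exact congrArg _ (vertex_eq _ _)

lemma opApply_app_one [IsPartialMonoid M] {ν : M ⟶ M.op} (hν : IsInversion ν) (f : M ⟶ M)
    (x : M _⦋1⦌) : opApply ν (f.app _ x) = f.app _ (opApply ν x) := by
  obtain ⟨w, h₁, h₂, h₃⟩ := hν.exists_triangle x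
  have := hν.eq_of_product (f.app _ w) (by
    rw [← app_unit f, ← h₃]; exact (app_map f _ _).symm)
  rw [← h₁]
  conv_lhs => rw [← h₂]
  refine Eq.trans (congrArg _ (app_map f _ _)) (this.symm.trans (app_map f _ _).symm)

/-- The reversed homotopy `(x, t) ↦ F(x⁻¹, 1 - t)⁻¹`. -/
def EndSimplex.reverse (ν : M ⟶ M.op) (F : EndSimplex M ⦋1⦌) : EndSimplex M ⦋1⦌ where
  app n := ↾fun x => opApply ν (F.app n (opApply ν x.1,
    SSet.stdSimplex.objEquiv.symm (SimplexCategory.rev.map (SSet.stdSimplex.objEquiv x.2))))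
  naturality n m θ := by
    refine ConcreteCategory.hom_ext _ _ fun x => ?_
    change opApply ν (F.app m (opApply ν (M.map θ x.1), _)) = M.map θ (opApply ν (F.app n _))
    rw [opApply_map]
    have h : M.map θ = M.map (SimplexCategory.rev.map
      (SimplexCategory.rev.map θ.unop).op.unop).op := by
      simp
    rw [h]
    refine Eq.trans ?_ (opApply_map ν (SimplexCategory.rev.map θ.unop).op _)
    refine congrArg _ (Eq.trans ?_ (app_map F (SimplexCategory.rev.map θ.unop).op _))
    exact congrArg (fun t => F.app m (M.map (SimplexCategory.rev.map θ.unop).op (opApply ν x.1),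
      SSet.stdSimplex.objEquiv.symm t))
      (SimplexCategory.rev.map_comp θ.unop (SSet.stdSimplex.objEquiv x.2))




lemma EndSimplex.atVertex_app {X : SSet.{u}} {n : SimplexCategory} (i : Fin (n.len + 1))
    (F : EndSimplex X n) {k : SimplexCategoryᵒᵖ} (x : X.obj k) :
    (EndSimplex.atVertex i F).app k x =
      F.app k (x, SSet.stdSimplex.objEquiv.symm (SimplexCategory.const k.unop n i)) := rfl

/-- The nondegenerate `1`-simplex `ι` of `Δ[1]`. -/
def fundamental : (Δ[1] : SSet.{u}) _⦋1⦌ := SSet.stdSimplex.objEquiv.symm (𝟙 ⦋1⦌)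

/-- The element `η = F(1, ι)` attached to `F : M × Δ[1] ⟶ M`. -/
noncomputable def evalUnit [IsPartialMonoid M] (F : EndSimplex M ⦋1⦌) : M _⦋1⦌ :=
  F.app _ (unit M, fundamental)

lemma prism₁ [IsPartialMonoid M] (F : EndSimplex M ⦋1⦌) (x : M _⦋1⦌) : ∃ w : M _⦋2⦌,
    M.δ 2 w = evalUnit F ∧ M.δ 0 w = (EndSimplex.atVertex 1 F).app _ x ∧
    M.δ 1 w = F.app _ (x, fundamental) := by
  refine ⟨F.app _ (M.σ 0 x, SSet.stdSimplex.objEquiv.symm (SimplexCategory.σ 1)), ?_, ?_, ?_⟩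
  · refine (app_map F _ _).symm.trans (congrArg (F.app _) (Prod.ext ?_ ?_))
    · refine (map_map _ _ _).trans ((map_congr (ψ := SimplexCategory.σ 0 ≫
        SimplexCategory.δ 1) (by decide) _).trans ((map_map _ _ _).symm.trans ?_))
      exact congrArg _ (vertex_eq _ _)
    · exact congrArg SSet.stdSimplex.objEquiv.symm
        (show SimplexCategory.δ 2 ≫ SimplexCategory.σ 1 = 𝟙 ⦋1⦌ by decide)
  · refine (app_map F _ _).symm.trans (congrArg (F.app _) (Prod.ext ?_ ?_))
    · exact (map_map _ _ _).trans ((map_congr (ψ := 𝟙 _) (by decide) _).trans (map_id_op _))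
    · exact congrArg SSet.stdSimplex.objEquiv.symm
        (show SimplexCategory.δ 0 ≫ SimplexCategory.σ 1 = SimplexCategory.const ⦋1⦌ ⦋1⦌ 1 by decide)
  · refine (app_map F _ _).symm.trans (congrArg (F.app _) (Prod.ext ?_ ?_))
    · exact (map_map _ _ _).trans ((map_congr (ψ := 𝟙 _) (by decide) _).trans (map_id_op _))
    · exact congrArg SSet.stdSimplex.objEquiv.symm
        (show SimplexCategory.δ 1 ≫ SimplexCategory.σ 1 = 𝟙 ⦋1⦌ by decide)

lemma prism₂ [IsPartialMonoid M] (F : EndSimplex M ⦋1⦌) (x : M _⦋1⦌) : ∃ w : M _⦋2⦌,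
    M.δ 2 w = (EndSimplex.atVertex 0 F).app _ x ∧ M.δ 0 w = evalUnit F ∧
    M.δ 1 w = F.app _ (x, fundamental) := by
  refine ⟨F.app _ (M.σ 1 x, SSet.stdSimplex.objEquiv.symm (SimplexCategory.σ 0)), ?_, ?_, ?_⟩
  · refine (app_map F _ _).symm.trans (congrArg (F.app _) (Prod.ext ?_ ?_))
    · exact (map_map _ _ _).trans ((map_congr (ψ := 𝟙 _) (by decide) _).trans (map_id_op _))
    · exact congrArg SSet.stdSimplex.objEquiv.symm
        (show SimplexCategory.δ 2 ≫ SimplexCategory.σ 0 = SimplexCategory.const ⦋1⦌ ⦋1⦌ 0 by decide)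
  · refine (app_map F _ _).symm.trans (congrArg (F.app _) (Prod.ext ?_ ?_))
    · refine (map_map _ _ _).trans ((map_congr (ψ := SimplexCategory.σ 0 ≫
        SimplexCategory.δ 0) (by decide) _).trans ((map_map _ _ _).symm.trans ?_))
      exact congrArg _ (vertex_eq _ _)
    · exact congrArg SSet.stdSimplex.objEquiv.symm
        (show SimplexCategory.δ 0 ≫ SimplexCategory.σ 0 = 𝟙 ⦋1⦌ by decide)
  · refine (app_map F _ _).symm.trans (congrArg (F.app _) (Prod.ext ?_ ?_))
    · exact (map_map _ _ _).trans ((map_congr (ψ := 𝟙 _) (by decide) _).trans (map_id_op _))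
    · exact congrArg SSet.stdSimplex.objEquiv.symm
        (show SimplexCategory.δ 1 ≫ SimplexCategory.σ 0 = 𝟙 ⦋1⦌ by decide)

lemma EndSimplex.ext_of_evalUnit [IsPartialMonoid M] {F G : EndSimplex M ⦋1⦌}
    (h₀ : atVertex 0 F = atVertex 0 G) (h₁ : atVertex 1 F = atVertex 1 G)
    (h : evalUnit F = evalUnit G) : F = G := by
  apply hom_ext_one
  rintro ⟨x, t⟩
  obtain ⟨t, rfl⟩ := SSet.stdSimplex.objEquiv.symm.surjective t
  rcases SimplexCategory.eq_of_one_to_one t with ⟨i, rfl⟩ | rfl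
  · have : i = 0 ∨ i = 1 := by fin_cases i <;> simp
    rcases this with rfl | rfl
    · exact congr($(h₀).app _ x)
    · exact congr($(h₁).app _ x)
  · obtain ⟨w, a₁, a₂, a₃⟩ := prism₁ F x
    obtain ⟨w', b₁, b₂, b₃⟩ := prism₁ G x
    have : w = w' := triangle_ext (by rw [a₁, b₁, h]) (by rw [a₂, b₂, h₁])
    exact a₃.symm.trans ((congrArg _ this).trans b₃)

lemma EndSimplex.reverse_atVertex [IsPartialMonoid M] {ν : M ⟶ M.op} (hν : IsInversion ν)
    (F : EndSimplex M ⦋1⦌) (i : Fin 2) :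
    atVertex (n := ⦋1⦌) i (F.reverse ν) = atVertex (n := ⦋1⦌) i.rev F := by
  apply hom_ext_one
  intro x
  have : opApply ν ((atVertex (n := ⦋1⦌) i.rev F).app _ (opApply ν x)) =
      (atVertex (n := ⦋1⦌) i.rev F).app _ x := by
    rw [opApply_app_one hν]
    exact congrArg _ (hν.involutive _ x)
  rw [← this]
  rfl

lemma opApply_unit [IsPartialMonoid M] (ν : M ⟶ M.op) : opApply ν (unit M) = unit M := by
  refine (opApply_map ν _ _).trans ?_
  refine (map_congr (ψ := SimplexCategory.σ 0) (by decide) _).trans ?_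
  exact congrArg _ (vertex_eq _ _)

lemma evalUnit_reverse [IsPartialMonoid M] (ν : M ⟶ M.op)
    (F : EndSimplex M ⦋1⦌) : evalUnit (F.reverse ν) = opApply ν (evalUnit F) := by
  have h : SimplexCategory.rev.map (𝟙 ⦋1⦌) = 𝟙 ⦋1⦌ := SimplexCategory.rev.map_id _
  change opApply ν (F.app _ (opApply ν (unit M),
    SSet.stdSimplex.objEquiv.symm (SimplexCategory.rev.map (𝟙 ⦋1⦌)))) = _
  rw [opApply_unit, h]
  rfl

/-- There is `F : M × Δ[1] ⟶ M` that restricts to `f` at the vertex `0` and to `g` at the vertex `1`. -/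
def IsHomotopic (f g : M ⟶ M) : Prop :=
  ∃ F : EndSimplex M ⦋1⦌, EndSimplex.atVertex (n := ⦋1⦌) 0 F = f ∧
    EndSimplex.atVertex (n := ⦋1⦌) 1 F = g

/-- The homotopy given by a map `M × Δ[1] ⟶ M`. -/
def homotopyMk {f g : M ⟶ M} (F : EndSimplex M ⦋1⦌)
    (h₀ : EndSimplex.atVertex (n := ⦋1⦌) 0 F = f) (h₁ : EndSimplex.atVertex (n := ⦋1⦌) 1 F = g) :
    SSet.Homotopy f g :=
  { h := F
    h₀ := h₀
    h₁ := h₁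
    rel := by
      refine NatTrans.ext (funext fun _ => ConcreteCategory.hom_ext _ _ ?_)
      rintro ⟨⟨_, h⟩, _⟩
      exact h.elim }

lemma isHomotopic_iff_nonempty (f g : M ⟶ M) : IsHomotopic f g ↔ Nonempty (SSet.Homotopy f g) := by
  constructor
  · rintro ⟨F, h₀, h₁⟩
    exact ⟨homotopyMk F h₀ h₁⟩
  · rintro ⟨H⟩
    exact ⟨H.h, H.h₀, H.h₁⟩

/-- The inner automorphisms of a partial group: the automorphisms homotopic to the identity. -/
def Inn (M : SSet.{u}) [IsPartialGroup M] : Subgroup (Aut M) where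
  carrier := {φ | Nonempty (SSet.Homotopy φ.hom (𝟙 M))}
  one_mem' := (isHomotopic_iff_nonempty _ _).1 ⟨1, rfl, rfl⟩
  mul_mem' := by
    intro φ ψ hφ hψ
    obtain ⟨F, h₀, h₁⟩ := (isHomotopic_iff_nonempty _ _).2 hφ
    obtain ⟨G, k₀, k₁⟩ := (isHomotopic_iff_nonempty _ _).2 hψ
    refine (isHomotopic_iff_nonempty _ _).1 ⟨F * G, ?_, ?_⟩
    · rw [map_mul, h₀, k₀]; rfl
    · rw [map_mul, h₁, k₁]; exact Category.id_comp _
  inv_mem' := by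
    intro φ hφ
    obtain ⟨F, h₀, h₁⟩ := (isHomotopic_iff_nonempty _ _).2 hφ
    obtain ⟨ν, hν⟩ := IsPartialGroup.exists_inversion (M := M)
    have e₀ := F.reverse_atVertex hν 0
    have e₁ := F.reverse_atVertex hν 1
    refine (isHomotopic_iff_nonempty _ _).1 ⟨F.reverse ν ≫ φ.inv, ?_, ?_⟩
    · change EndSimplex.atVertex (n := ⦋1⦌) 0 (F.reverse ν) ≫ φ.inv = φ.inv
      rw [e₀]
      exact (congrArg (· ≫ φ.inv) h₁).trans (Category.id_comp _)
    · change EndSimplex.atVertex (n := ⦋1⦌) 1 (F.reverse ν) ≫ φ.inv = 𝟙 M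
      rw [e₁]
      exact (congrArg (· ≫ φ.inv) h₀).trans φ.hom_inv_id

instance (M : SSet.{u}) [IsPartialGroup M] : (Inn M).Normal where
  conj_mem φ hφ ψ := by
    obtain ⟨F, h₀, h₁⟩ := (isHomotopic_iff_nonempty _ _).2 hφ
    refine (isHomotopic_iff_nonempty _ _).1 ⟨ψ.inv ▷ _ ≫ F ≫ ψ.hom, ?_, ?_⟩
    · change ψ.inv ≫ EndSimplex.atVertex (n := ⦋1⦌) 0 F ≫ ψ.hom = _
      rw [h₀]; rfl
    · change ψ.inv ≫ EndSimplex.atVertex (n := ⦋1⦌) 1 F ≫ ψ.hom = _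
      rw [h₁]
      exact (congrArg (ψ.inv ≫ ·) (Category.id_comp ψ.hom)).trans ψ.inv_hom_id

/-- The outer automorphism group: automorphisms modulo inner automorphisms. By `Out.mk_eq_mk_iff` its
elements are the homotopy classes of automorphisms. -/
abbrev Out (M : SSet.{u}) [IsPartialGroup M] : Type u := Aut M ⧸ Inn M

lemma Out.mk_eq_mk_iff [IsPartialGroup M] (φ ψ : Aut M) :
    (QuotientGroup.mk φ : Out M) = QuotientGroup.mk ψ ↔
      Nonempty (SSet.Homotopy φ.hom ψ.hom) := by
  rw [eq_comm, QuotientGroup.eq]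
  constructor
  · intro h
    obtain ⟨F, h₀, h₁⟩ := (isHomotopic_iff_nonempty _ _).2 h
    refine (isHomotopic_iff_nonempty _ _).1 ⟨F ≫ ψ.hom, ?_, ?_⟩
    · change EndSimplex.atVertex (n := ⦋1⦌) 0 F ≫ ψ.hom = _
      rw [h₀]
      change (φ.hom ≫ ψ.inv) ≫ ψ.hom = _
      rw [Category.assoc, ψ.inv_hom_id, Category.comp_id]
    · change EndSimplex.atVertex (n := ⦋1⦌) 1 F ≫ ψ.hom = _
      rw [h₁]
      exact Category.id_comp ψ.hom
  · intro h
    obtain ⟨F, h₀, h₁⟩ := (isHomotopic_iff_nonempty _ _).2 h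
    refine (isHomotopic_iff_nonempty _ _).1 ⟨F ≫ ψ.inv, ?_, ?_⟩
    · change EndSimplex.atVertex (n := ⦋1⦌) 0 F ≫ ψ.inv = _
      rw [h₀]
      rfl
    · change EndSimplex.atVertex (n := ⦋1⦌) 1 F ≫ ψ.inv = _
      rw [h₁]
      exact ψ.hom_inv_id

/-- The self-homotopies of the identity of `M`, as a submonoid of `Map(M, M)₁`. -/
def centralLoops (M : SSet.{u}) : Submonoid (EndSimplex M ⦋1⦌) :=
  MonoidHom.mker (EndSimplex.atVertex (X := M) (n := ⦋1⦌) 0) ⊓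
    MonoidHom.mker (EndSimplex.atVertex (X := M) (n := ⦋1⦌) 1)

lemma evalUnit_mul_comm [IsPartialMonoid M] {F G : EndSimplex M ⦋1⦌} (hF : F ∈ centralLoops M)
    (hG : G ∈ centralLoops M) : evalUnit (F * G) = evalUnit (G * F) := by
  obtain ⟨w, a₁, a₂, a₃⟩ := prism₁ F (evalUnit G)
  obtain ⟨w', b₁, b₂, b₃⟩ := prism₂ G (evalUnit F)
  have hF1 : EndSimplex.atVertex (n := ⦋1⦌) 1 F = 1 := hF.2
  have hG0 : EndSimplex.atVertex (n := ⦋1⦌) 0 G = 1 := hG.1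
  rw [hF1] at a₂
  rw [hG0] at b₁
  have : w = w' := triangle_ext (a₁.trans b₁.symm) (a₂.trans b₂.symm)
  exact a₃.symm.trans ((congrArg _ this).trans b₃)

lemma evalUnit_one [IsPartialMonoid M] : evalUnit (1 : EndSimplex M ⦋1⦌) = unit M := rfl

lemma centralLoops_ext [IsPartialMonoid M] {F G : EndSimplex M ⦋1⦌} (hF : F ∈ centralLoops M)
    (hG : G ∈ centralLoops M) (h : evalUnit F = evalUnit G) : F = G :=
  EndSimplex.ext_of_evalUnit (hF.1.trans hG.1.symm) (hF.2.trans hG.2.symm) h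

lemma exists_inv_centralLoops [IsPartialGroup M] (F : centralLoops M) :
    ∃ G : centralLoops M, G * F = 1 := by
  obtain ⟨ν, hν⟩ := IsPartialGroup.exists_inversion (M := M)
  have hR : F.1.reverse ν ∈ centralLoops M :=
    ⟨(F.1.reverse_atVertex hν 0).trans F.2.2, (F.1.reverse_atVertex hν 1).trans F.2.1⟩
  refine ⟨⟨F.1.reverse ν, hR⟩, Subtype.ext ?_⟩
  refine centralLoops_ext (mul_mem hR F.2) (one_mem _) ?_
  obtain ⟨w, a₁, a₂, a₃⟩ := prism₁ (F.1.reverse ν) (evalUnit F.1)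
  obtain ⟨w', b₁, b₂, b₃⟩ := hν.exists_triangle (evalUnit F.1)
  have h1 : EndSimplex.atVertex (n := ⦋1⦌) 1 (F.1.reverse ν) = 1 := hR.2
  rw [h1] at a₂
  have : w = w' := triangle_ext (a₁.trans ((evalUnit_reverse ν _).trans b₁.symm))
    (a₂.trans b₂.symm)
  exact a₃.symm.trans ((congrArg _ this).trans b₃)

/-- On a partial group the self-homotopies of the identity form an abelian group. -/
noncomputable instance centralLoops.commGroup [IsPartialGroup M] : CommGroup (centralLoops M) :=
  { (inferInstance : Monoid (centralLoops M)) with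
    inv := fun F => (exists_inv_centralLoops F).choose
    inv_mul_cancel := fun F => (exists_inv_centralLoops F).choose_spec
    mul_comm := fun F G => Subtype.ext (centralLoops_ext (mul_mem F.2 G.2) (mul_mem G.2 F.2)
      (evalUnit_mul_comm F.2 G.2)) }

/-- The center of `M`: the elements `η` of `M₁` that define a self-homotopy of the identity. -/
def Center (M : SSet.{u}) [IsPartialMonoid M] : Type u :=
  {η : M _⦋1⦌ // ∃ H : SSet.Homotopy (𝟙 M) (𝟙 M), H.h.app _ (unit M, fundamental) = η}

/-- A self-homotopy of the identity is determined by its element `η`. -/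
noncomputable def centerEquiv (M : SSet.{u}) [IsPartialMonoid M] : centralLoops M ≃ Center M :=
  Equiv.ofBijective (fun F => ⟨evalUnit F.1, by
      obtain ⟨F, h₀, h₁⟩ := F
      exact ⟨homotopyMk F h₀ h₁, rfl⟩⟩)
    ⟨fun F G h => Subtype.ext (centralLoops_ext F.2 G.2 congr($(h).1)),
     by
      rintro ⟨_, H, rfl⟩
      exact ⟨⟨H.h, H.h₀, H.h₁⟩, rfl⟩⟩

/-- The group structure of the center. By `Center.mul_spec` it is the product of `M`. -/
noncomputable instance Center.commGroup (M : SSet.{u}) [IsPartialGroup M] : CommGroup (Center M) :=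
  (centerEquiv M).symm.commGroup

/-- The product in the center is the product `Π[η|ζ]` of the partial group. -/
lemma Center.mul_spec [IsPartialGroup M] (η ζ : Center M) :
    ∃ w : M _⦋2⦌, edge 0 w = η.1 ∧ edge 1 w = ζ.1 ∧ product w = (η * ζ).1 := by
  obtain ⟨F, rfl⟩ := (centerEquiv M).surjective η
  obtain ⟨G, rfl⟩ := (centerEquiv M).surjective ζ
  obtain ⟨w, a₁, a₂, a₃⟩ := prism₁ F.1 (evalUnit G.1)
  have hF1 : EndSimplex.atVertex (n := ⦋1⦌) 1 F.1 = 1 := F.2.2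
  rw [hF1] at a₂
  refine ⟨w, (map_congr (by decide) _).trans a₁, (map_congr (by decide) _).trans a₂, ?_⟩
  have : centerEquiv M F * centerEquiv M G = centerEquiv M (F * G) := by
    change centerEquiv M (_ * _) = _
    simp
  rw [this]
  exact (map_congr (by decide) _).trans a₃

end PartialGroups

section SimplicialGroups

/-- The set of connected components of (the simplicial set underlying) a simplicial group. -/
def PiZero (G : SimplicialObject GrpCat.{u}) : Type u := SSet.π₀ (under G)

namespace PiZero

variable {G : SimplicialObject GrpCat.{u}}

/-- The connected component of a vertex. -/
def mk (x : G.obj (op ⦋0⦌)) : PiZero G := SSet.π₀.mk (X := under G) x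

lemma sound {x y : G.obj (op ⦋0⦌)} (s : G.obj (op ⦋1⦌)) (h₁ : G.δ 1 s = x) (h₀ : G.δ 0 s = y) :
    mk x = mk y :=
  SSet.π₀.sound (X := under G) (SSet.Edge.mk (X := under G) s h₁ h₀)

lemma ind {motive : PiZero G → Prop} (h : ∀ x : G.obj (op ⦋0⦌), motive (mk x)) (a : PiZero G) :
    motive a := by
  obtain ⟨x, rfl⟩ := SSet.π₀.mk_surjective (X := under G) a
  exact h x

/-- Maps out of the set of connected components. -/
def lift {T : Type u} (f : G.obj (op ⦋0⦌) → T)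
    (hf : ∀ s : G.obj (op ⦋1⦌), f (G.δ 1 s) = f (G.δ 0 s)) : PiZero G → T :=
  SSet.π₀.lift (X := under G) f (fun _ _ e =>
    (congrArg f e.src_eq).symm.trans ((hf e.edge).trans (congrArg f e.tgt_eq)))

lemma δ_σ (i : Fin 2) (x : G.obj (op ⦋0⦌)) : G.δ i (G.σ 0 x) = x := by
  have h : G.σ 0 ≫ G.δ i = 𝟙 _ := by
    fin_cases i
    · exact G.δ_comp_σ_self' rfl
    · exact G.δ_comp_σ_succ' rfl
  exact congr($h x)

/-- The group structure on the connected components of a simplicial group, induced by the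
multiplication of vertices: `mk x * mk y = mk (x * y)`. -/
instance group (G : SimplicialObject GrpCat.{u}) : Group (PiZero G) where
  mul a b := lift (fun x => lift (fun y => mk (x * y)) (fun s =>
      sound (G.σ 0 x * s) (by rw [map_mul, δ_σ]) (by rw [map_mul, δ_σ])) b)
    (fun s => by
      induction b using ind with | h y
      exact sound (s * G.σ 0 y) (by rw [map_mul, δ_σ]) (by rw [map_mul, δ_σ])) a
  one := mk 1
  inv := lift (fun x => mk x⁻¹) (fun s => sound s⁻¹ (map_inv _ _) (map_inv _ _))
  mul_assoc a b c := by
    induction a using ind with | h x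
    induction b using ind with | h y
    induction c using ind with | h z
    exact congrArg mk (mul_assoc x y z)
  one_mul a := by
    induction a using ind with | h x
    exact congrArg mk (one_mul x)
  mul_one a := by
    induction a using ind with | h x
    exact congrArg mk (mul_one x)
  inv_mul_cancel a := by
    induction a using ind with | h x
    exact congrArg mk (inv_mul_cancel x)

end PiZero

/-- The canonical homomorphism `aut M ⟶ Out M` to the discrete group `Out M`: it sends a simplex to
the homotopy class of any of its vertices. -/
def outProj (M : SSet.{u}) [IsPartialGroup M] : aut M ⟶ constGroup (Out M) where
  app n := GrpCat.ofHom ((QuotientGroup.mk' (Inn M)).comp (autAtVertex M (n := n.unop) 0))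
  naturality n m θ := by
    refine GrpCat.ext fun F => ?_
    refine Eq.symm ((Out.mk_eq_mk_iff _ _).2 ?_)
    refine (isHomotopic_iff_nonempty _ _).1 ⟨EndSimplex.restrict
      (SimplexCategory.mkOfLe (n := n.unop.len) 0 (θ.unop.toOrderHom 0) (Fin.zero_le _)) F.val, ?_, ?_⟩
    · rfl
    · rfl

end SimplicialGroups

section HomotopyGroups

/-- The `n`-th homotopy group (as a set, `n ≥ 1`) of a Kan complex `X` at a vertex `x`: `n`-simplices
whose boundary is constant at `x`, where two of them are identified if they are the last two faces of
an `(n+1)`-simplex whose other faces are constant at `x`. -/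
def homotopyClasses (X : SSet.{u}) (n : ℕ) (x : X _⦋0⦌) : Type u :=
  Quot fun f g : X.PtSimplex n x => Nonempty (f.RelStruct g (Fin.last n))

/-- The image of an `n`-simplex with constant boundary. -/
def PtSimplex.map {X Y : SSet.{u}} (f : X ⟶ Y) {n : ℕ} {x : X _⦋0⦌} (s : X.PtSimplex n x) :
    Y.PtSimplex n (f.app _ x) where
  map := s.map ≫ f
  comm := by
    rw [← Category.assoc, s.comm]
    simp [SSet.const_comp]

/-- The map induced on homotopy groups. -/
def homotopyClasses.map {X Y : SSet.{u}} (f : X ⟶ Y) (n : ℕ) (x : X _⦋0⦌) :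
    homotopyClasses X n x → homotopyClasses Y n (f.app _ x) :=
  Quot.map (PtSimplex.map f) (by
    rintro s t ⟨r⟩
    exact ⟨{
      map := r.map ≫ f
      δ_castSucc_map := by rw [r.δ_castSucc_map_assoc]; rfl
      δ_succ_map := by rw [r.δ_succ_map_assoc]; rfl
      δ_map_of_lt := fun j hj => by rw [r.δ_map_of_lt_assoc j hj, SSet.const_comp]
      δ_map_of_gt := fun j hj => by rw [r.δ_map_of_gt_assoc j hj, SSet.const_comp] }⟩)

/-- An isomorphism from the homotopy group `π_{n+1}(X, x)` of a Kan complex `X` to a group `A`. The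
product of the classes of `f` and `g` is the class of `h` whenever `g, h, f` are the last three faces
of an `(n+2)`-simplex whose other faces are constant; in a Kan complex such an `h` always exists. -/
structure HomotopyGroupIso (X : SSet.{u}) (n : ℕ) (x : X _⦋0⦌) (A : Type u) [Group A] extends
    homotopyClasses X (n + 1) x ≃ A where
  map_mul : ∀ f g h : X.PtSimplex (n + 1) x, Nonempty (f.MulStruct g h (Fin.last n)) →
    toFun (Quot.mk _ h) = toFun (Quot.mk _ f) * toFun (Quot.mk _ g)

/-- A map of Kan complexes is a weak equivalence if it is bijective on connected components and
induces isomorphisms on all homotopy groups at all vertices. -/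
structure IsWeakEquivalence {X Y : SSet.{u}} (f : X ⟶ Y) : Prop where
  bijective_π₀ : Function.Bijective (SSet.mapπ₀ f)
  bijective_π : ∀ (n : ℕ), 1 ≤ n → ∀ x : X _⦋0⦌, Function.Bijective (homotopyClasses.map f n x)

/-- The fibre of `p` over the vertex `b`. -/
abbrev fiber {E B : SSet.{u}} (p : E ⟶ B) (b : B _⦋0⦌) : SSet.{u} :=
  ((SSet.Subcomplex.ofSimplex b).preimage p : SSet.{u})

/-- `F ⟶ E ⟶ B` is a fibration sequence of Kan complexes: `p` is a Kan fibration onto a Kan complex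
(right lifting property with respect to all horn inclusions) and `i` factors through a weak equivalence
from the Kan complex `F` to the fibre of `p` over `b`. -/
structure IsFibrationSequence {F E B : SSet.{u}} (i : F ⟶ E) (p : E ⟶ B) (b : B _⦋0⦌) : Prop where
  kanComplex_fibre : SSet.KanComplex F
  kanComplex_base : SSet.KanComplex B
  fibration : SSet.modelCategoryQuillen.J.rlp p
  exists_weakEquivalence : ∃ w : F ⟶ fiber p b,
    w ≫ ((SSet.Subcomplex.ofSimplex b).preimage p).ι = i ∧ IsWeakEquivalence w

end HomotopyGroups


end PGrp

open PGrp

/-! The proof rests on two rigidity facts. A simplicial map into `M` is determined by its values on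
1-simplices, so a simplex of aut(M) is determined by its edges (`aut_ext_of_edges`). An edge, being
a homotopy, is determined by its end points and its element η = F(1, ι)
(`EndSimplex.ext_of_evalUnit`). The inversion also makes every homotopy between automorphisms
invertible in Map(M, M) (`exists_aut_edge`). Hence edges of aut(M) join exactly the homotopic
automorphisms, and π₀ is Out(M).

The simplices of aut(M) with all vertices the identity form a simplicial subgroup. Reading off η
along their edges identifies it with BZ(M) (`centralToBar_map`, `centralToBar_injective`,
`centralToBar_surjective`), and j is the inverse of this identification. Translation by a vertex α
carries the loops at α into this subgroup, whence π₁ = Z(M). A pointed simplex of dimension at least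
2 has degenerate edges, so it is itself degenerate and the higher groups vanish.

Since q is levelwise surjective, Bq is a Kan fibration: a relative form of Moore's filling argument
(`exists_filler`) is applied to each edge between the vertex k of a horn and another vertex
(`rlp_horns_bar_map`). The fibre is the bar construction of the kernel of q, and B²Z(M) sits in it
as the part whose group elements have identity vertices. From dimension 2 on, a simplex of the fibre
with all faces in B²Z(M) lies in B²Z(M) (`exists_toFiber_of_faces`); this gives the bijection on π_n
for n ≥ 2. For π₁, B²Z(M) is simply connected, and every edge of the fibre deforms into it along
paths between inner automorphisms (`exists_deformation`). -/

namespace PGrp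

/-! ### Horn filling for simplicial groups and their classifying spaces -/

section HornFilling

/-- A criterion for Kan fibrations in terms of compatible families of simplices. -/
lemma rlp_horns_of_exists_filler {E B : SSet.{u}} (p : E ⟶ B)
    (h : ∀ (n : ℕ) (k : Fin (n + 2)) (x : Fin (n + 2) → E _⦋n⦌) (y : B _⦋n + 1⦌),
      (∀ i j, i ≠ k → j ≠ k → ∀ θ θ' : ⦋n⦌ ⟶ ⦋n⦌,
        θ ≫ SimplexCategory.δ i = θ' ≫ SimplexCategory.δ j →
        E.map θ.op (x i) = E.map θ'.op (x j)) →
      (∀ j, j ≠ k → p.app _ (x j) = B.map (SimplexCategory.δ j).op y) →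
      ∃ z : E _⦋n + 1⦌, p.app _ z = y ∧ ∀ j, j ≠ k → E.map (SimplexCategory.δ j).op z = x j) :
    SSet.modelCategoryQuillen.J.rlp p := by
  intro _ _ _ hf
  simp only [SSet.modelCategoryQuillen.J, MorphismProperty.iSup_iff] at hf
  obtain ⟨n, ⟨k⟩⟩ := hf
  refine ⟨fun {t b} sq => ?_⟩
  have hmem : ∀ j, j ≠ k → SSet.stdSimplex.objEquiv.symm (SimplexCategory.δ j) ∈
      (SSet.horn.{u} (n + 1) k).obj (op ⦋n⦌) := fun j hj =>
    (SSet.objEquiv_symm_δ_mem_horn_iff j k).2 hj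
  have hne : ∃ j : Fin (n + 2), j ≠ k := exists_ne k
  let s : ∀ j, j ≠ k → (SSet.horn.{u} (n + 1) k : SSet) _⦋n⦌ := fun j hj => ⟨_, hmem j hj⟩
  -- The horn has no face `k`; the value there is arbitrary and is borrowed from another face.
  let x : Fin (n + 2) → E _⦋n⦌ := fun j =>
    if hj : j ≠ k then t.app _ (s j hj) else t.app _ (s _ hne.choose_spec)
  have hx : ∀ j hj, x j = t.app _ (s j hj) := fun j hj => dif_pos hj
  have hb : ∀ {m : SimplexCategory} (θ : m ⟶ ⦋n + 1⦌),
      b.app _ (SSet.stdSimplex.objEquiv.symm θ) = B.map θ.op (SSet.yonedaEquiv b) := by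
    intro m θ
    obtain ⟨b, rfl⟩ := SSet.yonedaEquiv.symm.surjective b
    rw [Equiv.apply_symm_apply]
    rfl
  obtain ⟨z, hz, hzx⟩ := h n k x (SSet.yonedaEquiv b) (by
    intro i j hi hj θ θ' e
    rw [hx i hi, hx j hj, ← app_map, ← app_map]
    congr 1
    apply Subtype.ext
    exact congrArg SSet.stdSimplex.objEquiv.symm e) (by
    intro j hj
    rw [hx j hj, ← hb]
    exact congr($(sq.w).app _ (s j hj)))
  refine ⟨⟨⟨SSet.yonedaEquiv.symm z, ?_, ?_⟩⟩⟩
  · refine SSet.horn.hom_ext _ _ fun j hj => ?_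
    exact (hzx j hj).trans (hx j hj)
  · apply SSet.yonedaEquiv.injective
    rw [SSet.yonedaEquiv_symm_comp, Equiv.apply_symm_apply, hz]

/-- The degeneracy that collapses the vertex `j` onto its neighbour on the side of `k` splits the
face `j`. The strict approach to `k` is what lets `exists_filler` correct one face without
disturbing those already correct. -/
lemma exists_retraction_δ {n : ℕ} {j k : Fin (n + 2)} (hjk : j ≠ k) :
    ∃ s : ⦋n + 1⦌ ⟶ ⦋n⦌, SimplexCategory.δ j ≫ s = 𝟙 _ ∧
      Nat.dist ((s ≫ SimplexCategory.δ j).toOrderHom j) k < Nat.dist j k := by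
  rcases lt_or_gt_of_ne hjk with h | h
  · obtain ⟨j, rfl⟩ := j.eq_castSucc_of_ne_last (Fin.ne_last_of_lt h)
    refine ⟨SimplexCategory.σ j, SimplexCategory.δ_comp_σ_self, ?_⟩
    have : (SimplexCategory.σ j ≫ SimplexCategory.δ j.castSucc).toOrderHom j.castSucc = j.succ := by
      simp [SimplexCategory.σ, SimplexCategory.δ]
    rw [this]
    simp only [Fin.lt_def, Nat.dist, Fin.val_succ, Fin.val_castSucc] at *
    omega
  · obtain ⟨j, rfl⟩ := j.eq_succ_of_ne_zero (Fin.ne_zero_of_lt h)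
    refine ⟨SimplexCategory.σ j, SimplexCategory.δ_comp_σ_succ, ?_⟩
    have : (SimplexCategory.σ j ≫ SimplexCategory.δ j.succ).toOrderHom j.succ = j.castSucc := by
      simp [SimplexCategory.σ, SimplexCategory.δ]
    rw [this]
    simp only [Fin.lt_def, Nat.dist, Fin.val_succ, Fin.val_castSucc] at *
    omega

variable {G Q : SimplicialObject GrpCat.{u}}

lemma grp_map_map (G : SimplicialObject GrpCat.{u}) {n m k : SimplexCategory} (θ : n ⟶ m)
    (ψ : m ⟶ k) (x : G.obj (op k)) : G.map θ.op (G.map ψ.op x) = G.map (θ ≫ ψ).op x := by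
  rw [op_comp, Functor.map_comp]; rfl

lemma grp_map_id (G : SimplicialObject GrpCat.{u}) {n : SimplexCategory} (x : G.obj (op n)) :
    G.map (𝟙 n).op x = x := by
  rw [op_id, CategoryTheory.Functor.map_id]; rfl

lemma grp_app_map (p : G ⟶ Q) {n m : SimplexCategoryᵒᵖ} (θ : n ⟶ m) (x : G.obj n) :
    p.app m (G.map θ x) = Q.map θ (p.app n x) :=
  congr($(p.naturality θ) x)

/-- The relative form of Moore's theorem: a compatible family of faces of a simplicial group, from
which at least one face is missing, has a filler over any given simplex of a quotient. -/
theorem exists_filler (p : G ⟶ Q) (hp : ∀ n, Function.Surjective (p.app n)) {n : ℕ}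
    (k : Fin (n + 2)) (S : Finset (Fin (n + 2))) (hk : k ∉ S)
    (x : Fin (n + 2) → G.obj (op ⦋n⦌)) (y : Q.obj (op ⦋n + 1⦌))
    (hx : ∀ i ∈ S, ∀ j ∈ S, i ≠ j → ∀ θ θ' : ⦋n⦌ ⟶ ⦋n⦌,
      θ ≫ SimplexCategory.δ i = θ' ≫ SimplexCategory.δ j →
      (∀ l, l ≠ i → l ≠ j → ∃ a, (θ ≫ SimplexCategory.δ i).toOrderHom a = l) →
      G.map θ.op (x i) = G.map θ'.op (x j))
    (hy : ∀ j ∈ S, p.app _ (x j) = Q.map (SimplexCategory.δ j).op y) :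
    ∃ z : G.obj (op ⦋n + 1⦌), p.app _ z = y ∧
      ∀ j ∈ S, G.map (SimplexCategory.δ j).op z = x j := by
  classical
  -- Faces far from `k` are corrected before nearer ones: the new `j` is at most as far from `k` as
  -- every index already in `S`.
  induction S using Finset.induction_on_min_value (fun j : Fin (n + 2) => Nat.dist j k) with
  | empty =>
    obtain ⟨z, hz⟩ := hp _ y
    exact ⟨z, hz, by simp⟩
  | insert j S hjS hmin ih =>
    obtain ⟨z, hz, hzS⟩ := ih (fun h => hk (Finset.mem_insert_of_mem h))
      (fun i hi j hj => hx i (Finset.mem_insert_of_mem hi) j (Finset.mem_insert_of_mem hj))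
      (fun j hj => hy j (Finset.mem_insert_of_mem hj))
    have hjk : j ≠ k := fun h => hk (h ▸ Finset.mem_insert_self _ _)
    obtain ⟨s, hs, hd⟩ := exists_retraction_δ hjk
    have hfix : ∀ l, l ≠ j → (s ≫ SimplexCategory.δ j).toOrderHom l = l := by
      intro l hl
      obtain ⟨l, rfl⟩ := Fin.exists_succAbove_eq hl
      have : (SimplexCategory.δ j ≫ s ≫ SimplexCategory.δ j) = SimplexCategory.δ j := by
        rw [← Category.assoc, hs, Category.id_comp]
      exact congr(($this).toOrderHom l)
    -- The error on the face `j` is pulled back along the retraction and multiplied in. It lies over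
    -- 1, since `z` and `x j` agree over the quotient, so the image stays `y`.
    refine ⟨z * G.map s.op ((G.map (SimplexCategory.δ j).op z)⁻¹ * x j), ?_, ?_⟩
    · rw [map_mul, hz, grp_app_map, map_mul, hy j (Finset.mem_insert_self _ _), map_inv,
        grp_app_map, hz]
      simp
    · intro i hi
      rw [map_mul, grp_map_map]
      by_cases hij : i = j
      · subst hij
        rw [hs, grp_map_id]
        simp
      · have hiS : i ∈ S := (Finset.mem_insert.1 hi).resolve_left hij
        rw [hzS i hiS, map_mul, map_inv, grp_map_map]
        -- On an old face `i` the correction is trivial. The composite with `s` misses the vertex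
        -- `i`: only `j` is moved, and it lands closer to `k` than any index in `S`. It therefore
        -- factors through the face `i`, where compatibility applies.
        obtain ⟨θ, hθ⟩ := SimplexCategory.eq_comp_δ_of_not_surjective'
          ((SimplexCategory.δ i ≫ s) ≫ SimplexCategory.δ j) i (by
            intro a ha
            have ha' : (s ≫ SimplexCategory.δ j).toOrderHom (i.succAbove a) = i := ha
            by_cases haj : i.succAbove a = j
            · rw [haj] at ha'
              rw [ha'] at hd
              exact absurd (hmin i hiS) (not_le.2 hd)
            · rw [hfix _ haj] at ha'
              exact Fin.succAbove_ne _ _ ha')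
        rw [hθ, ← grp_map_map, hzS i hiS, hx i hi j (Finset.mem_insert_self _ _) hij θ _ hθ.symm]
        · simp
        · intro l hli hlj
          obtain ⟨a, rfl⟩ := Fin.exists_succAbove_eq hli
          refine ⟨a, ?_⟩
          rw [← hθ]
          exact hfix _ hlj

/-- A levelwise surjective homomorphism of simplicial groups is a Kan fibration. -/
theorem rlp_horns_under (p : G ⟶ Q) (hp : ∀ n, Function.Surjective (p.app n)) :
    SSet.modelCategoryQuillen.J.rlp (Functor.whiskerRight p (forget GrpCat)) := by
  refine rlp_horns_of_exists_filler _ fun n k x y hx hy => ?_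
  classical
  obtain ⟨z, hz, hzx⟩ := exists_filler p hp k (Finset.univ.erase k) (by simp) x y
    (fun i hi j hj _ θ θ' e _ => hx i j (Finset.ne_of_mem_erase hi) (Finset.ne_of_mem_erase hj) θ θ' e)
    (fun j hj => hy j (Finset.ne_of_mem_erase hj))
  exact ⟨z, hz, fun j hj => hzx j (by simpa using hj)⟩

/-- A levelwise surjective homomorphism of simplicial groups induces a Kan fibration of classifying
spaces. -/
theorem rlp_horns_bar_map (p : G ⟶ Q) (hp : ∀ n, Function.Surjective (p.app n)) :
    SSet.modelCategoryQuillen.J.rlp (bar.map p) := by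
  refine rlp_horns_of_exists_filler _ fun n k c y hc hy => ?_
  classical
  have hface : ∀ j a b, j ≠ k → p.app _ ((c j).toFun a b) =
      Q.map (SimplexCategory.δ j).op (BarSimplex.toFun y (j.succAbove a) (j.succAbove b)) :=
    fun j a b hj => congr(BarSimplex.toFun $(hy j hj) a b)
  -- `r j i` is the position of the vertex `i` within the face `j`.
  choose! r hr using fun (j i : Fin (n + 2)) (h : i ≠ j) => Fin.exists_succAbove_eq h
  have hr' : ∀ j a, r j (j.succAbove a) = a := fun j a =>
    Fin.succAbove_right_injective (hr j _ (Fin.succAbove_ne _ _))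
  -- `z i` is to be the edge from `k` to `i`. The horn prescribes its `j`-th face whenever the face
  -- `j` contains both end points, that is for `j` different from `k` and `i`.
  have key : ∀ i, ∃ z : G.obj (op ⦋n + 1⦌), p.app _ z = BarSimplex.toFun y k i ∧
      ∀ j ∈ (Finset.univ.erase k).erase i, G.map (SimplexCategory.δ j).op z =
        (c j).toFun (r j k) (r j i) := by
    intro i
    refine exists_filler p hp k _ (by simp) _ _ ?_ ?_
    · intro j hj j' hj' _ θ θ' e he
      simp only [Finset.mem_erase, Finset.mem_univ, and_true] at hj hj'
      -- Compatibility of the bar simplices only compares edges between vertices that the operator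
      -- hits. The surjectivity clause in `exists_filler` guarantees that `k` and `i` are among
      -- them.
      obtain ⟨a, ha⟩ := he k hj.2.symm hj'.2.symm
      obtain ⟨b, hb⟩ := he i hj.1.symm hj'.1.symm
      have h1 : ∀ a l, (θ ≫ SimplexCategory.δ j).toOrderHom a = l → r j l = θ.toOrderHom a := by
        rintro a _ rfl; exact hr' j _
      have h2 : ∀ a l, (θ ≫ SimplexCategory.δ j).toOrderHom a = l → r j' l = θ'.toOrderHom a := by
        rintro a _ rfl; rw [e]; exact hr' j' _
      rw [h1 a k ha, h1 b i hb, h2 a k ha, h2 b i hb]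
      exact congr(BarSimplex.toFun $(hc j j' hj.2 hj'.2 θ θ' e) a b)
    · intro j hj
      simp only [Finset.mem_erase, Finset.mem_univ, and_true] at hj
      rw [hface j _ _ hj.2, hr j k hj.2.symm, hr j i hj.1.symm]
  choose z hz hzc using key
  -- The edges out of `k` serve as a potential, so the cocycle identity is automatic; `z k` need not
  -- be 1.
  refine ⟨⟨fun a b => (z a)⁻¹ * z b, fun a b c => by group⟩, BarSimplex.ext fun a b => ?_,
    fun j hj => BarSimplex.ext fun a b => ?_⟩
  · change p.app _ ((z a)⁻¹ * z b) = _
    rw [map_mul, map_inv, hz, hz, inv_mul_eq_iff_eq_mul, y.cocycle]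
  · change G.map _ ((z (j.succAbove a))⁻¹ * z (j.succAbove b)) = _
    rw [map_mul, map_inv, hzc _ j (by simp [hj, (Fin.succAbove_ne j a).symm]),
      hzc _ j (by simp [hj, (Fin.succAbove_ne j b).symm]), inv_mul_eq_iff_eq_mul,
      hr', hr']
    exact ((c j).cocycle _ _ _).symm

-- A simplicial set with exactly one simplex in each degree is terminal, so lifting against `p` is
-- the same as lifting against the map to the point. The trivial group and its bar construction are
-- such bases.
open SSet.modelCategoryQuillen in
lemma kanComplex_of_rlp {E B : SSet.{u}} (p : E ⟶ B) (hB : ∀ n, Nonempty (Unique (B.obj n)))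
    (h : SSet.modelCategoryQuillen.J.rlp p) : SSet.KanComplex E := by
  have hsub : ∀ {X : SSet.{u}} (f g : X ⟶ B), f = g := fun f g => by
    ext n x
    obtain ⟨_⟩ := hB n
    exact Subsingleton.elim _ _
  refine (HomotopicalAlgebra.isFibrant_iff _).2 ⟨?_⟩
  rw [SSet.modelCategoryQuillen.fibrations_eq]
  intro _ Y f hf
  let b : Y ⟶ B :=
    { app := fun n => ↾fun _ => (hB n).some.default
      naturality := fun n m θ => by
        obtain ⟨_⟩ := hB m
        exact ConcreteCategory.hom_ext _ _ fun _ => Subsingleton.elim _ _ }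
  refine ⟨fun {t _} sq => ?_⟩
  obtain ⟨⟨l⟩⟩ := (h f hf).sq_hasLift (show CommSq t f p b from ⟨hsub _ _⟩)
  exact ⟨⟨⟨l.l, l.fac_left, CategoryTheory.Limits.terminal.hom_ext _ _⟩⟩⟩

/-- The trivial homomorphism to the trivial simplicial group. -/
def toTrivial (G : SimplicialObject GrpCat.{u}) : G ⟶ constGroup PUnit.{u + 1} where
  app n := GrpCat.ofHom 1

lemma toTrivial_surjective (G : SimplicialObject GrpCat.{u}) (n : SimplexCategoryᵒᵖ) :
    Function.Surjective ((toTrivial G).app n) := fun _ => ⟨1, rfl⟩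

/-- Moore's theorem: simplicial groups are Kan complexes. -/
theorem kanComplex_under (G : SimplicialObject GrpCat.{u}) : SSet.KanComplex (under G) :=
  kanComplex_of_rlp _ (fun _ => ⟨inferInstanceAs (Unique PUnit)⟩)
    (rlp_horns_under _ (toTrivial_surjective G))

/-- Classifying spaces of simplicial groups are Kan complexes. -/
theorem kanComplex_bar (G : SimplicialObject GrpCat.{u}) : SSet.KanComplex (bar G) :=
  kanComplex_of_rlp _ (fun n => ⟨⟨⟨(⟨fun _ _ => PUnit.unit, fun _ _ _ => rfl⟩ :
      BarSimplex PUnit n.unop.len)⟩, fun _ => rfl⟩⟩)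
    (rlp_horns_bar_map _ (toTrivial_surjective G))

end HornFilling

/-! ### Simplices of aut(M) with identity vertices, and the bar construction of the center -/

section CentralSimplices

variable {M : SSet.{u}}

/-- The simplices of `aut X` all of whose vertices are the identity. -/
def centralSimplices (X : SSet.{u}) (n : SimplexCategory) : Subgroup ((aut X).obj (op n)) :=
  ⨅ i : Fin (n.len + 1), (autAtVertex X i).ker

lemma autAtVertex_eq_one_iff {X : SSet.{u}} {n : SimplexCategory} (i : Fin (n.len + 1))
    (g : (aut X).obj (op n)) : autAtVertex X i g = 1 ↔ EndSimplex.atVertex i g.val = 1 :=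
  ⟨fun h => congr($(h).hom), fun h => Aut.ext h⟩

lemma mem_centralSimplices {X : SSet.{u}} {n : SimplexCategory} {g : (aut X).obj (op n)} :
    g ∈ centralSimplices X n ↔ ∀ i : Fin (n.len + 1), autAtVertex X i g = 1 := by
  simp [centralSimplices, Subgroup.mem_iInf, MonoidHom.mem_ker]

lemma autAtVertex_map {X : SSet.{u}} {n m : SimplexCategory} (θ : n ⟶ m)
    (g : (aut X).obj (op m)) (i : Fin (n.len + 1)) :
    autAtVertex X i ((aut X).map θ.op g) = autAtVertex X (θ.toOrderHom i) g := rfl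

lemma map_mem_centralSimplices {X : SSet.{u}} {n m : SimplexCategory} (θ : n ⟶ m)
    {g : (aut X).obj (op m)} (hg : g ∈ centralSimplices X m) :
    (aut X).map θ.op g ∈ centralSimplices X n :=
  mem_centralSimplices.2 fun i => (autAtVertex_map θ g i).trans (mem_centralSimplices.1 hg _)

lemma mem_centralLoops_of_mem {g : (aut M).obj (op ⦋1⦌)} (hg : g ∈ centralSimplices M ⦋1⦌) :
    g.val ∈ centralLoops M :=
  ⟨(autAtVertex_eq_one_iff _ _).1 (mem_centralSimplices.1 hg 0),
    (autAtVertex_eq_one_iff _ _).1 (mem_centralSimplices.1 hg 1)⟩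

/-- The edge from the `i`-th to the `j`-th vertex. -/
def autEdge (X : SSet.{u}) {n : SimplexCategory} (i j : Fin (n.len + 1)) (h : i ≤ j) :
    (aut X).obj (op n) →* (aut X).obj (op ⦋1⦌) :=
  ((aut X).map (SimplexCategory.mkOfLe (n := n.len) i j h : ⦋1⦌ ⟶ n).op).hom

lemma autEdge_map {X : SSet.{u}} {n m : SimplexCategory} (θ : n ⟶ m) (g : (aut X).obj (op m))
    (i j : Fin (n.len + 1)) (h : i ≤ j) :
    autEdge X i j h ((aut X).map θ.op g) =
      autEdge X (θ.toOrderHom i) (θ.toOrderHom j) (θ.toOrderHom.monotone h) g := by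
  change (aut X).map _ ((aut X).map θ.op g) = (aut X).map _ g
  rw [grp_map_map, show SimplexCategory.mkOfLe (n := n.len) i j h ≫ θ =
    SimplexCategory.mkOfLe (n := m.len) _ _ (θ.toOrderHom.monotone h) by
      ext a
      fin_cases a <;> rfl]

lemma autEdge_mem_centralSimplices {X : SSet.{u}} {n : SimplexCategory} (i j : Fin (n.len + 1))
    (h : i ≤ j) {g : (aut X).obj (op n)} (hg : g ∈ centralSimplices X n) :
    autEdge X i j h g ∈ centralSimplices X ⦋1⦌ := map_mem_centralSimplices _ hg

/-- The simplices of the automorphism complex of a partial monoid are determined by their edges. -/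
lemma aut_ext_of_edges [IsPartialMonoid M] {n : SimplexCategory} {f g : (aut M).obj (op n)}
    (h : ∀ i j hij, autEdge M i j hij f = autEdge M i j hij g) : f = g := by
  refine Units.ext (hom_ext_one ?_)
  rintro ⟨x, t⟩
  obtain ⟨t, rfl⟩ := SSet.stdSimplex.objEquiv.symm.surjective t
  -- A 1-simplex of Δ[n] is the edge between its end points, so the value at `(x, t)` is the value
  -- of that edge of the simplex at `(x, ι)`.
  have ht : t = SimplexCategory.mkOfLe (n := n.len) (t.toOrderHom 0) (t.toOrderHom 1)
      (t.toOrderHom.monotone (Fin.zero_le _)) := by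
    ext a
    fin_cases a <;> rfl
  rw [ht]
  have := h (t.toOrderHom 0) (t.toOrderHom 1) (t.toOrderHom.monotone (Fin.zero_le _))
  exact congr((Units.val $this).app _ (x, fundamental))

/-- Restricting `g` to the vertex of `M` times Δ[n], the triangle `i ≤ j ≤ k` becomes a 2-simplex of
`M` whose edges are the elements η. This is how composition of edges turns into the product of `M`.
-/
lemma exists_triangle_evalUnit [IsPartialMonoid M] {n : SimplexCategory} (g : (aut M).obj (op n))
    (i j k : Fin (n.len + 1)) (hij : i ≤ j) (hjk : j ≤ k) : ∃ w : M _⦋2⦌,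
    M.δ 2 w = evalUnit (autEdge M i j hij g).val ∧
    M.δ 0 w = evalUnit (autEdge M j k hjk g).val ∧
    M.δ 1 w = evalUnit (autEdge M i k (hij.trans hjk) g).val := by
  refine ⟨g.val.app _ (M.map (SimplexCategory.const ⦋2⦌ ⦋0⦌ 0).op (vertex M),
    SSet.stdSimplex.objEquiv.symm (SimplexCategory.mkOfLeComp (n := n.len) i j k hij hjk)),
    ?_, ?_, ?_⟩ <;>
  · refine (app_map g.val _ _).symm.trans (congrArg (g.val.app _) (Prod.ext ?_ ?_))
    · exact (map_map _ _ _).trans (map_congr (by decide) _)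
    · refine congrArg SSet.stdSimplex.objEquiv.symm ?_
      ext a
      fin_cases a <;> rfl

variable [IsPartialGroup M]

/-- The element of the center given by an edge of a central simplex. -/
noncomputable def centralEdge {n : SimplexCategory} (i j : Fin (n.len + 1)) (h : i ≤ j) :
    centralSimplices M n →* Center M where
  toFun g := centerEquiv M
    ⟨(autEdge M i j h g.1).val, mem_centralLoops_of_mem (autEdge_mem_centralSimplices i j h g.2)⟩
  map_one' := by
    have : (1 : Center M) = centerEquiv M 1 := rfl
    rw [this]
    congr 1
  map_mul' f g := by
    have : ∀ a b, centerEquiv M a * centerEquiv M b = centerEquiv M (a * b) := by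
      intro a b
      change centerEquiv M (_ * _) = _
      simp
    rw [this]
    congr 1

lemma centralEdge_val {n : SimplexCategory} (i j : Fin (n.len + 1)) (h : i ≤ j)
    (g : centralSimplices M n) : (centralEdge i j h g).val = evalUnit (autEdge M i j h g.1).val :=
  rfl

/-- The triangle that defines the product in the center and the one from `exists_triangle_evalUnit`
have the same spine, hence coincide. -/
lemma centralEdge_mul {n : SimplexCategory} (i j k : Fin (n.len + 1)) (hij : i ≤ j) (hjk : j ≤ k)
    (g : centralSimplices M n) :
    centralEdge i j hij g * centralEdge j k hjk g = centralEdge i k (hij.trans hjk) g := by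
  obtain ⟨w, a₂, a₀, a₁⟩ := Center.mul_spec (centralEdge i j hij g) (centralEdge j k hjk g)
  obtain ⟨w', b₂, b₀, b₁⟩ := exists_triangle_evalUnit g.1 i j k hij hjk
  have h2 : M.δ 2 w = edge 0 w := map_congr (by decide) _
  have h0 : M.δ 0 w = edge 1 w := map_congr (by decide) _
  have h1 : M.δ 1 w = product w := map_congr (by decide) _
  have : w = w' := triangle_ext ((h2.trans a₂).trans b₂.symm) ((h0.trans a₀).trans b₀.symm)
  exact Subtype.ext (a₁.symm.trans (h1.symm.trans ((congrArg _ this).trans b₁)))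

/-- The simplex of the bar construction given by the edges of a central simplex. -/
noncomputable def centralToBar (M : SSet.{u}) [IsPartialGroup M] (n : SimplexCategory) :
    centralSimplices M n →* BarSimplex (Center M) n.len where
  -- A backward pair has no edge in Δ[n], so all values are expressed through the edges from the
  -- vertex 0.
  toFun g := ⟨fun i j => (centralEdge 0 i (Fin.zero_le _) g)⁻¹ * centralEdge 0 j (Fin.zero_le _) g,
    fun i j k => by group⟩
  map_one' := BarSimplex.ext fun i j => by
    simp [show (1 : BarSimplex (Center M) n.len).toFun i j = 1 from rfl]
  map_mul' f g := BarSimplex.ext fun i j => by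
    rw [show ∀ a b : BarSimplex (Center M) n.len, (a * b).toFun i j = a.toFun i j * b.toFun i j
      from fun _ _ => rfl]
    simp only [map_mul, mul_inv]
    exact mul_mul_mul_comm _ _ _ _

lemma centralToBar_of_le {n : SimplexCategory} (g : centralSimplices M n) (i j : Fin (n.len + 1))
    (h : i ≤ j) : (centralToBar M n g).toFun i j = centralEdge i j h g :=
  inv_mul_eq_iff_eq_mul.2 (centralEdge_mul _ _ _ _ _ g).symm

lemma centralToBar_map {n m : SimplexCategory} (θ : n ⟶ m) (g : centralSimplices M m) :
    centralToBar M n ⟨(aut M).map θ.op g.1, map_mem_centralSimplices θ g.2⟩ =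
      (barGroup (Center M)).map θ.op (centralToBar M m g) := by
  have key : ∀ i : Fin (n.len + 1), centralEdge 0 i (Fin.zero_le _)
      ⟨(aut M).map θ.op g.1, map_mem_centralSimplices θ g.2⟩ =
      (centralToBar M m g).toFun (θ.toOrderHom 0) (θ.toOrderHom i) := by
    intro i
    rw [centralToBar_of_le g _ _ (θ.toOrderHom.monotone (Fin.zero_le _))]
    exact Subtype.ext congr(evalUnit (Units.val $(autEdge_map θ g.1 0 i (Fin.zero_le _))))
  refine BarSimplex.ext fun i j => ?_
  change (centralEdge _ _ _ _)⁻¹ * centralEdge _ _ _ _ = _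
  rw [key, key, inv_mul_eq_iff_eq_mul]
  exact ((centralToBar M m g).cocycle _ _ _).symm

/-- Edges determine a simplex, and η determines a self-homotopy of the identity. -/
lemma centralToBar_injective (n : SimplexCategory) : Function.Injective (centralToBar M n) := by
  intro f g h
  refine Subtype.ext (aut_ext_of_edges fun i j hij => Units.ext ?_)
  refine centralLoops_ext (mem_centralLoops_of_mem (autEdge_mem_centralSimplices i j hij f.2))
    (mem_centralLoops_of_mem (autEdge_mem_centralSimplices i j hij g.2)) ?_
  have := congr(BarSimplex.toFun $h i j)
  rw [centralToBar_of_le _ _ _ hij, centralToBar_of_le _ _ _ hij] at this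
  exact congrArg Subtype.val this

/-- A self-homotopy of the identity as an edge of `aut M`. -/
noncomputable def loopToAut (F : centralLoops M) : centralSimplices M ⦋1⦌ :=
  -- Invertibility holds because the self-homotopies of the identity already form a group.
  ⟨Units.map (centralLoops M).subtype (toUnits F), mem_centralSimplices.2 fun i => by
    refine (autAtVertex_eq_one_iff _ _).2 ?_
    change Fin 2 at i
    have : i = 0 ∨ i = 1 := by fin_cases i <;> simp
    rcases this with rfl | rfl
    · exact F.2.1
    · exact F.2.2⟩

lemma centralToBar_loopToAut (F : centralLoops M) :
    (centralToBar M ⦋1⦌ (loopToAut F)).toFun 0 1 = centerEquiv M F := by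
  rw [centralToBar_of_le (n := ⦋1⦌) _ 0 1 (Fin.zero_le _)]
  refine congrArg (centerEquiv M) (Subtype.ext ?_)
  change EndSimplex.restrict _ F.1 = F.1
  rw [show SimplexCategory.mkOfLe (n := 1) 0 1 (Fin.zero_le _) = 𝟙 ⦋1⦌ by decide]
  change M ◁ SSet.stdSimplex.map (𝟙 _) ≫ F.1 = F.1
  exact (congrArg (M ◁ · ≫ F.1) (CategoryTheory.Functor.map_id SSet.stdSimplex _)).trans rfl

/-- The map `[n] ⟶ [1]` that sends the vertices up to the `i`-th one to `0`. -/
def cut (n : ℕ) (i : Fin n) : ⦋n⦌ ⟶ ⦋1⦌ :=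
  SimplexCategory.Hom.mk ⟨fun a => if a ≤ i.castSucc then 0 else 1, fun a b h => by
    dsimp only
    split_ifs with h₁ h₂
    · exact le_rfl
    · exact Fin.zero_le _
    · exact absurd (h.trans ‹_›) h₁
    · exact le_rfl⟩

lemma BarSimplex.self {A : Type u} [Group A] {n : ℕ} (c : BarSimplex A n) (i : Fin (n + 1)) :
    c.toFun i i = 1 := by simpa using c.cocycle i i i

/-- Evaluation at an edge. -/
def BarSimplex.evalHom {A : Type u} [CommGroup A] {n : ℕ} (i j : Fin (n + 1)) :
    BarSimplex A n →* A where
  toFun c := c.toFun i j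
  map_one' := rfl
  map_mul' _ _ := rfl

/-- Over an abelian group, `[g₁|…|gₙ]` is the product of the pullbacks of the edges `[gᵢ]` along the
maps `cut n i`: each pullback has one nontrivial spine entry. The image is a subgroup compatible
with simplicial operators, so it suffices to realise edges. -/
lemma centralToBar_surjective (n : ℕ) : Function.Surjective (centralToBar M ⦋n⦌) := by
  rw [← MonoidHom.range_eq_top, eq_top_iff]
  rintro (c : BarSimplex (Center M) n) -
  let b : Fin n → centralSimplices M ⦋1⦌ := fun i =>
    loopToAut ((centerEquiv M).symm (c.toFun i.castSucc i.succ))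
  have hb : ∀ i, (centralToBar M ⦋1⦌ (b i)).toFun 0 1 = c.toFun i.castSucc i.succ := fun i =>
    (centralToBar_loopToAut _).trans (Equiv.apply_symm_apply _ _)
  have hc : c = ∏ i : Fin n, centralToBar M ⦋n⦌
      ⟨(aut M).map (cut n i).op (b i).1, map_mem_centralSimplices _ (b i).2⟩ := by
    apply BarSimplex.spineEquiv.injective
    funext l
    change c.toFun _ _ = BarSimplex.evalHom l.castSucc l.succ _
    rw [map_prod, Finset.prod_eq_single l]
    · rw [centralToBar_map]
      change _ = BarSimplex.toFun (centralToBar M ⦋1⦌ (b l))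
        (if l.castSucc ≤ l.castSucc then 0 else 1) (if l.succ ≤ l.castSucc then 0 else 1)
      rw [if_pos le_rfl, if_neg (not_le.2 Fin.castSucc_lt_succ)]
      exact (hb l).symm
    · intro i _ hi
      rw [centralToBar_map]
      change BarSimplex.toFun (centralToBar M ⦋1⦌ (b i))
        (if l.castSucc ≤ i.castSucc then 0 else 1) (if l.succ ≤ i.castSucc then 0 else 1) = 1
      have : (l.castSucc ≤ i.castSucc ↔ l.succ ≤ i.castSucc) := by
        have : l.val ≠ i.val := fun h => hi (Fin.ext h).symm
        simp only [Fin.le_def, Fin.val_castSucc, Fin.val_succ]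
        omega
      simp only [this]
      exact BarSimplex.self _ _
    · simp
  rw [hc]
  exact Subgroup.prod_mem _ fun i _ => ⟨_, rfl⟩

/-- The central simplices form the bar construction of the center. -/
noncomputable def centralEquiv (M : SSet.{u}) [IsPartialGroup M] (n : SimplexCategory) :
    centralSimplices M n ≃* BarSimplex (Center M) n.len :=
  MulEquiv.ofBijective (centralToBar M n)
    ⟨centralToBar_injective n, centralToBar_surjective n.len⟩

/-- The homomorphism from the bar construction of the center to the automorphism complex. -/
noncomputable def centerHom (M : SSet.{u}) [IsPartialGroup M] : barGroup (Center M) ⟶ aut M where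
  app n := GrpCat.ofHom ((centralSimplices M n.unop).subtype.comp
    (centralEquiv M n.unop).symm.toMonoidHom)
  naturality n m θ := by
    refine GrpCat.ext fun c => ?_
    obtain ⟨g, rfl⟩ := (centralEquiv M n.unop).surjective c
    change ((centralEquiv M m.unop).symm _).1 = (aut M).map θ ((centralEquiv M n.unop).symm _).1
    rw [MulEquiv.symm_apply_apply]
    exact congrArg Subtype.val
      ((centralEquiv M m.unop).symm_apply_eq.2 (centralToBar_map θ.unop g).symm)

lemma centerHom_mem (n : SimplexCategory) (c : (barGroup (Center M)).obj (op n)) :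
    (centerHom M).app _ c ∈ centralSimplices M n :=
  ((centralEquiv M n).symm c).2

lemma centerHom_centralEquiv (n : SimplexCategory) (g : centralSimplices M n) :
    (centerHom M).app (op n) (centralEquiv M n g) = g.1 :=
  congrArg Subtype.val ((centralEquiv M n).symm_apply_apply g)

lemma centerHom_injective (n : SimplexCategoryᵒᵖ) : Function.Injective ((centerHom M).app n) :=
  Subtype.val_injective.comp (centralEquiv M n.unop).symm.injective

lemma evalUnit_centerHom (c : BarSimplex (Center M) 1) :
    evalUnit (((centerHom M).app (op ⦋1⦌)).hom c).val = (c.toFun 0 1).val := by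
  obtain ⟨g, rfl⟩ := (centralEquiv M ⦋1⦌).surjective c
  rw [show (((centerHom M).app (op ⦋1⦌)).hom (centralEquiv M ⦋1⦌ g)) = g.1 from
    centerHom_centralEquiv ⦋1⦌ g]
  change _ = ((centralToBar M ⦋1⦌ g).toFun 0 1).val
  rw [centralToBar_of_le (n := ⦋1⦌) _ 0 1 (Fin.zero_le _), centralEdge_val]
  congr 2
  change _ = (aut M).map (SimplexCategory.mkOfLe (n := 1) 0 1 (Fin.zero_le _)).op g.1
  rw [show SimplexCategory.mkOfLe (n := 1) 0 1 (Fin.zero_le _) = 𝟙 ⦋1⦌ by decide, grp_map_id]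

end CentralSimplices

/-! ### Pointed simplices and their homotopies as plain simplices -/

section PointedSimplices

variable {X : SSet.{u}} {x : X _⦋0⦌}

/-- The degeneracies of a vertex. -/
def degenerateVertex (x : X _⦋0⦌) (n : SimplexCategory) : X.obj (op n) :=
  X.map (SimplexCategory.const n ⦋0⦌ 0).op x

lemma map_degenerateVertex {n m : SimplexCategory} (θ : n ⟶ m) :
    X.map θ.op (degenerateVertex x m) = degenerateVertex x n := map_map _ _ _

lemma yonedaEquiv_const_eq {n : SimplexCategory} :
    SSet.yonedaEquiv (SSet.const x : SSet.stdSimplex.obj n ⟶ X) = degenerateVertex x n := rfl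

lemma yonedaEquiv_δ_comp {n : ℕ} (i : Fin (n + 2)) (f : Δ[n + 1] ⟶ X) :
    SSet.yonedaEquiv (SSet.stdSimplex.δ i ≫ f) =
      X.map (SimplexCategory.δ i).op (SSet.yonedaEquiv f) :=
  SSet.stdSimplex.yonedaEquiv_δ_comp _ _

/-- The simplex given by a pointed simplex. -/
def ptSimplexVal {n : ℕ} (f : X.PtSimplex n x) : X _⦋n⦌ := SSet.yonedaEquiv f.map

lemma ptSimplexVal_injective {n : ℕ} :
    Function.Injective (ptSimplexVal : X.PtSimplex n x → X _⦋n⦌) := fun _ _ h =>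
  SSet.RelativeMorphism.ext (SSet.yonedaEquiv.injective h)

/-- An operator from lower dimension lands in the boundary, where the simplex is constant. General
operators are allowed because vertices and edges are needed besides faces. -/
lemma map_ptSimplexVal {n m : ℕ} (f : X.PtSimplex n x) (h : m < n) (θ : ⦋m⦌ ⟶ ⦋n⦌) :
    X.map θ.op (ptSimplexVal f) = degenerateVertex x ⦋m⦌ := by
  have : (Δ[m] : SSet.{u}).HasDimensionLT n := SSet.hasDimensionLT_of_le _ (m + 1) n
  have := f.comp_map_eq_const (SSet.stdSimplex.map θ)
  rw [← yonedaEquiv_const_eq, ← this, SSet.yonedaEquiv_comp, SSet.yonedaEquiv_map]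
  obtain ⟨t, ht⟩ := SSet.yonedaEquiv.symm.surjective f.map
  rw [ptSimplexVal, ← ht, Equiv.apply_symm_apply]
  rfl

lemma δ_ptSimplexVal {n : ℕ} (f : X.PtSimplex (n + 1) x) (i : Fin (n + 2)) :
    X.map (SimplexCategory.δ i).op (ptSimplexVal f) = degenerateVertex x ⦋n⦌ :=
  map_ptSimplexVal f (by omega) _

lemma exists_ptSimplex {n : ℕ} (s : X _⦋n + 1⦌)
    (h : ∀ i, X.map (SimplexCategory.δ i).op s = degenerateVertex x ⦋n⦌) :
    ∃ f : X.PtSimplex (n + 1) x, ptSimplexVal f = s := by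
  refine ⟨⟨SSet.yonedaEquiv.symm s, SSet.boundary.hom_ext fun i => ?_⟩,
    Equiv.apply_symm_apply _ _⟩
  apply SSet.yonedaEquiv.injective
  rw [SSet.boundary.ι_ι_assoc, yonedaEquiv_δ_comp, Equiv.apply_symm_apply, h]
  rfl

lemma nonempty_relStruct_iff {n : ℕ} (f g : X.PtSimplex n x) :
    Nonempty (f.RelStruct g (Fin.last n)) ↔ ∃ s : X _⦋n + 1⦌,
      X.map (SimplexCategory.δ (Fin.last n).castSucc).op s = ptSimplexVal f ∧
      X.map (SimplexCategory.δ (Fin.last (n + 1))).op s = ptSimplexVal g ∧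
      ∀ j, j < (Fin.last n).castSucc →
        X.map (SimplexCategory.δ j).op s = degenerateVertex x ⦋n⦌ := by
  constructor
  · rintro ⟨r⟩
    refine ⟨SSet.yonedaEquiv r.map, ?_, ?_, fun j hj => ?_⟩
    · rw [← yonedaEquiv_δ_comp, r.δ_castSucc_map]; rfl
    · rw [← yonedaEquiv_δ_comp, ← Fin.succ_last, r.δ_succ_map]; rfl
    · rw [← yonedaEquiv_δ_comp, r.δ_map_of_lt j hj]; rfl
  · rintro ⟨s, h₁, h₂, h₃⟩
    refine ⟨⟨SSet.yonedaEquiv.symm s, ?_, ?_, fun j hj => ?_, fun j hj => ?_⟩⟩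
    · apply SSet.yonedaEquiv.injective
      rw [yonedaEquiv_δ_comp, Equiv.apply_symm_apply, h₁]; rfl
    · apply SSet.yonedaEquiv.injective
      rw [yonedaEquiv_δ_comp, Equiv.apply_symm_apply, Fin.succ_last, h₂]; rfl
    · apply SSet.yonedaEquiv.injective
      rw [yonedaEquiv_δ_comp, Equiv.apply_symm_apply, h₃ j hj]; rfl
    -- No face comes after the last two, so this condition is empty.
    · exact absurd (Fin.le_last j) (not_le.2 (Fin.succ_last n ▸ hj))

end PointedSimplices

/-! ### Homotopy groups of the automorphism complex -/

section HomotopyGroupsOfAut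

variable {M : SSet.{u}}

lemma homotopy_of_aut_edge (g : (aut M).obj (op ⦋1⦌)) :
    Nonempty (SSet.Homotopy (autAtVertex M (n := ⦋1⦌) 0 g).hom
      (autAtVertex M (n := ⦋1⦌) 1 g).hom) :=
  (isHomotopic_iff_nonempty _ _).1 ⟨g.val, rfl, rfl⟩

lemma autZeroEquiv_δ_one (g : (aut M).obj (op ⦋1⦌)) :
    autZeroEquiv M ((aut M).δ 1 g) = autAtVertex M (n := ⦋1⦌) 0 g := rfl

lemma autZeroEquiv_δ_zero (g : (aut M).obj (op ⦋1⦌)) :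
    autZeroEquiv M ((aut M).δ 0 g) = autAtVertex M (n := ⦋1⦌) 1 g := rfl

variable (α : (under (aut M)) _⦋0⦌)

/-- The degeneracies of a vertex of `aut M`, as elements of a group. -/
def degenerateAut (n : SimplexCategory) : (aut M).obj (op n) :=
  (aut M).map (SimplexCategory.const n ⦋0⦌ 0).op α

lemma map_degenerateAut {n m : SimplexCategory} (θ : n ⟶ m) :
    (aut M).map θ.op (degenerateAut α m) = degenerateAut α n := grp_map_map _ _ _ _

lemma autAtVertex_degenerateAut (n : SimplexCategory) (i : Fin (n.len + 1)) :
    autAtVertex M i (degenerateAut α n) = autZeroEquiv M α := rfl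

lemma autAtVertex_ptSimplexVal {α : (under (aut M)) _⦋0⦌} {n : ℕ} (f : (under (aut M)).PtSimplex (n + 1) α)
    (i : Fin (n + 2)) :
    autAtVertex M (n := ⦋n + 1⦌) i (ptSimplexVal f) = autZeroEquiv M α := by
  have := map_ptSimplexVal f (Nat.succ_pos n) (SimplexCategory.const ⦋0⦌ ⦋n + 1⦌ i)
  exact congrArg (fun t => autAtVertex M (n := ⦋0⦌) 0 t) this

variable [IsPartialGroup M]

/-- A homotopy between automorphisms of a partial group is invertible. -/
lemma exists_aut_edge (φ ψ : Aut M) (h : Nonempty (SSet.Homotopy φ.hom ψ.hom)) :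
    ∃ g : (aut M).obj (op ⦋1⦌), autAtVertex M (n := ⦋1⦌) 0 g = φ ∧
      autAtVertex M (n := ⦋1⦌) 1 g = ψ := by
  obtain ⟨F, h₀, h₁⟩ := (isHomotopic_iff_nonempty _ _).2 h
  obtain ⟨ν, hν⟩ := IsPartialGroup.exists_inversion (M := M)
  -- The candidate inverse of `F` is φ⁻¹ ∘ F̄ ∘ ψ⁻¹ with F̄ the reversed homotopy from ψ to φ. It
  -- runs from φ⁻¹ to ψ⁻¹, and its element is φ⁻¹(η⁻¹) for η the element of `F`.
  let G : EndSimplex M ⦋1⦌ := ψ.inv ▷ _ ≫ F.reverse ν ≫ φ.inv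
  have k₀ : EndSimplex.atVertex (n := ⦋1⦌) 0 G = φ.inv := by
    change ψ.inv ≫ EndSimplex.atVertex (n := ⦋1⦌) 0 (F.reverse ν) ≫ φ.inv = φ.inv
    rw [F.reverse_atVertex hν 0]
    refine (congrArg (fun t => ψ.inv ≫ t ≫ φ.inv) h₁).trans ?_
    rw [ψ.inv_hom_id_assoc]
  have k₁ : EndSimplex.atVertex (n := ⦋1⦌) 1 G = ψ.inv := by
    change ψ.inv ≫ EndSimplex.atVertex (n := ⦋1⦌) 1 (F.reverse ν) ≫ φ.inv = ψ.inv
    rw [F.reverse_atVertex hν 1]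
    refine (congrArg (fun t => ψ.inv ≫ t ≫ φ.inv) h₀).trans ?_
    rw [φ.hom_inv_id, Category.comp_id]
  have kG : evalUnit G = φ.inv.app _ (opApply ν (evalUnit F)) := by
    rw [← evalUnit_reverse]
    change φ.inv.app _ ((F.reverse ν).app _ (ψ.inv.app _ (unit M), fundamental)) = _
    rw [app_unit]
    rfl
  have hφ : ∀ y : M _⦋1⦌, φ.hom.app _ (φ.inv.app _ y) = y := fun y =>
    congr($(φ.inv_hom_id).app _ y)
  have hFG : F * G = 1 := by
    refine EndSimplex.ext_of_evalUnit ?_ ?_ ?_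
    · rw [map_mul, map_one, h₀, k₀]; exact φ.inv_hom_id
    · rw [map_mul, map_one, h₁, k₁]; exact ψ.inv_hom_id
    -- The element of `F * G` is `F` at the element of `G`, which is the product of the triangle
    -- [η⁻¹|η].
    · obtain ⟨w, a₂, a₀, a₁⟩ := prism₂ F (evalUnit G)
      obtain ⟨w', b₂, b₀, b₁⟩ := hν.exists_triangle (evalUnit F)
      have : w = w' := triangle_ext (by rw [a₂, b₂, h₀, kG, hφ]) (a₀.trans b₀.symm)
      exact a₁.symm.trans ((congrArg _ this).trans b₁)
  have hGF : G * F = 1 := by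
    refine EndSimplex.ext_of_evalUnit ?_ ?_ ?_
    · rw [map_mul, map_one, h₀, k₀]; exact φ.hom_inv_id
    · rw [map_mul, map_one, h₁, k₁]; exact ψ.hom_inv_id
    -- Here the triangle is the image of [η|η⁻¹] under φ⁻¹.
    · obtain ⟨w, a₂, a₀, a₁⟩ := prism₂ G (evalUnit F)
      obtain ⟨w', b₂, b₀, b₁⟩ := hν.exists_triangle (opApply ν (evalUnit F))
      rw [hν.involutive] at b₂
      have : w = φ.inv.app _ w' := triangle_ext
        (by
          rw [a₂, k₀, ← b₂]
          exact app_map φ.inv _ w')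
        (by
          rw [a₀, kG]
          refine (congrArg (φ.inv.app _) b₀.symm).trans ?_
          exact app_map φ.inv _ w')
      refine a₁.symm.trans ((congrArg _ this).trans ?_)
      refine (app_map φ.inv _ w').symm.trans ((congrArg _ b₁).trans (app_unit _))
  exact ⟨⟨F, G, hFG, hGF⟩, Aut.ext h₀, Aut.ext h₁⟩

/-- The class of an automorphism depends only on its component. -/
noncomputable def piZeroToOut (M : SSet.{u}) [IsPartialGroup M] : PiZero (aut M) → Out M :=
  PiZero.lift (fun a => QuotientGroup.mk (autZeroEquiv M a)) fun g => by
    rw [autZeroEquiv_δ_one, autZeroEquiv_δ_zero]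
    exact (Out.mk_eq_mk_iff _ _).2 (homotopy_of_aut_edge g)

/-- The components of the automorphism complex are the outer automorphisms. -/
noncomputable def piZeroAutEquiv (M : SSet.{u}) [IsPartialGroup M] : PiZero (aut M) ≃* Out M :=
  MulEquiv.ofBijective (MonoidHom.mk' (piZeroToOut M) (by
    intro a b
    induction a using PiZero.ind with | h a
    induction b using PiZero.ind with | h b
    change (QuotientGroup.mk (autZeroEquiv M (a * b)) : Out M) =
      QuotientGroup.mk (autZeroEquiv M a) * QuotientGroup.mk (autZeroEquiv M b)
    rw [map_mul]
    rfl)) (by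
    constructor
    · intro a b h
      induction a using PiZero.ind with | h a
      induction b using PiZero.ind with | h b
      obtain ⟨g, h₀, h₁⟩ := exists_aut_edge _ _ ((Out.mk_eq_mk_iff _ _).1 h)
      exact PiZero.sound g ((autZeroEquiv M).injective ((autZeroEquiv_δ_one g).trans h₀))
        ((autZeroEquiv M).injective ((autZeroEquiv_δ_zero g).trans h₁))
    · intro a
      obtain ⟨a, rfl⟩ := QuotientGroup.mk_surjective a
      exact ⟨PiZero.mk ((autZeroEquiv M).symm a),
        congrArg QuotientGroup.mk ((autZeroEquiv M).apply_symm_apply a)⟩)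

variable {α} in
/-- A simplex with constant vertices, translated to the identity. -/
def translate {n : SimplexCategory} (s : (aut M).obj (op n))
    (hs : ∀ i : Fin (n.len + 1), autAtVertex M i s = autZeroEquiv M α) : centralSimplices M n :=
  ⟨s * (degenerateAut α n)⁻¹, mem_centralSimplices.2 fun i => by
    rw [map_mul, map_inv, hs, autAtVertex_degenerateAut, mul_inv_cancel]⟩

/-- Translation commutes with simplicial operators, because the degeneracies of α do; faces of a
translated simplex are thus read off in the bar construction. -/
lemma translate_map {n m : SimplexCategory} (θ : n ⟶ m) (s : (aut M).obj (op m))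
    (hs : ∀ i : Fin (m.len + 1), autAtVertex M i s = autZeroEquiv M α) (t : (aut M).obj (op n))
    (ht : (aut M).map θ.op s = t)
    (ht' : ∀ i : Fin (n.len + 1), autAtVertex M i t = autZeroEquiv M α) (i j : Fin (n.len + 1)) :
    (centralToBar M n (translate t ht')).toFun i j =
      (centralToBar M m (translate s hs)).toFun (θ.toOrderHom i) (θ.toOrderHom j) := by
  have : translate t ht' = ⟨(aut M).map θ.op (translate s hs).1,
      map_mem_centralSimplices θ (translate s hs).2⟩ := by
    refine Subtype.ext ?_
    change t * (degenerateAut α n)⁻¹ = (aut M).map θ.op (s * (degenerateAut α m)⁻¹)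
    rw [map_mul, map_inv, map_degenerateAut, ht]
  rw [this, centralToBar_map]
  rfl

lemma eq_of_translate {n : SimplexCategory} {s t : (aut M).obj (op n)}
    (hs : ∀ i : Fin (n.len + 1), autAtVertex M i s = autZeroEquiv M α)
    (ht : ∀ i : Fin (n.len + 1), autAtVertex M i t = autZeroEquiv M α)
    (h : centralToBar M n (translate s hs) = centralToBar M n (translate t ht)) : s = t :=
  mul_right_cancel congr(Subtype.val $(centralToBar_injective n h))

lemma centralToBar_translate_degenerateAut (n : SimplexCategory) (i j : Fin (n.len + 1)) :
    (centralToBar M n (translate _ (autAtVertex_degenerateAut α n))).toFun i j = 1 := by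
  have : translate _ (autAtVertex_degenerateAut α n) = 1 := Subtype.ext (mul_inv_cancel _)
  rw [this, map_one]
  rfl

variable {α}

/-- The element of the center given by a loop of `aut M`. -/
noncomputable def loopClass (f : (under (aut M)).PtSimplex 1 α) : Center M :=
  (centralToBar M ⦋1⦌ (translate _ (autAtVertex_ptSimplexVal f))).toFun 0 1

lemma loopClass_injective : Function.Injective (loopClass (M := M) (α := α)) := by
  intro f g h
  refine ptSimplexVal_injective (eq_of_translate α (autAtVertex_ptSimplexVal f)
    (autAtVertex_ptSimplexVal g) (BarSimplex.spineEquiv.injective ?_))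
  funext i
  have : i = 0 := Subsingleton.elim (α := Fin 1) _ _
  subst this
  exact h

/-- Undo the translation: a central edge with prescribed element, times the degenerate edge at α, is
a loop at α. -/
lemma loopClass_surjective : Function.Surjective (loopClass (M := M) (α := α)) := by
  intro z
  obtain ⟨g, hg⟩ := centralToBar_surjective (M := M) 1 (BarSimplex.spineEquiv.symm fun _ => z)
  have hz : (centralToBar M ⦋1⦌ g).toFun 0 1 = z := by
    rw [hg]
    exact congrFun (BarSimplex.spineEquiv.apply_symm_apply fun _ : Fin 1 => z) 0
  have hv : ∀ i : Fin 2, autAtVertex M (n := ⦋1⦌) i (g.1 * degenerateAut α ⦋1⦌) =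
      autZeroEquiv M α := by
    intro i
    rw [map_mul, mem_centralSimplices.1 g.2 i, one_mul]
    rfl
  obtain ⟨f, hf⟩ := exists_ptSimplex (X := under (aut M)) (x := α) (n := 0)
    (g.1 * degenerateAut α ⦋1⦌) (by
      intro i
      apply (autZeroEquiv M).injective
      exact hv (i.succAbove 0))
  refine ⟨f, ?_⟩
  rw [← hz]
  have : translate _ (autAtVertex_ptSimplexVal f) = g := by
    refine Subtype.ext ?_
    change ptSimplexVal f * (degenerateAut α ⦋1⦌)⁻¹ = g.1
    rw [hf]
    exact mul_inv_cancel_right _ _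
  rw [loopClass, this]

/-- After translation the relation is the cocycle identity of a 2-simplex of BZ(M), with `f`, `g`,
`h` on the edges 01, 12, 02. -/
lemma loopClass_mul (f g h : (under (aut M)).PtSimplex 1 α) (s : (aut M).obj (op ⦋2⦌))
    (h₀ : (aut M).map (SimplexCategory.δ 0).op s = ptSimplexVal g)
    (h₁ : (aut M).map (SimplexCategory.δ 1).op s = ptSimplexVal h)
    (h₂ : (aut M).map (SimplexCategory.δ 2).op s = ptSimplexVal f) :
    loopClass h = loopClass f * loopClass g := by
  have hs : ∀ i : Fin 3, autAtVertex M (n := ⦋2⦌) i s = autZeroEquiv M α := by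
    intro i
    fin_cases i
    · exact (congrArg (autAtVertex M (n := ⦋1⦌) 0) h₁).trans (autAtVertex_ptSimplexVal h 0)
    · exact (congrArg (autAtVertex M (n := ⦋1⦌) 0) h₀).trans (autAtVertex_ptSimplexVal g 0)
    · exact (congrArg (autAtVertex M (n := ⦋1⦌) 1) h₀).trans (autAtVertex_ptSimplexVal g 1)
  have e₀ := translate_map α _ s hs _ h₀ (autAtVertex_ptSimplexVal g) 0 1
  have e₁ := translate_map α _ s hs _ h₁ (autAtVertex_ptSimplexVal h) 0 1
  have e₂ := translate_map α _ s hs _ h₂ (autAtVertex_ptSimplexVal f) 0 1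
  exact e₁.trans ((BarSimplex.cocycle _ 0 1 2).symm.trans (congrArg₂ _ e₂.symm e₀.symm))

lemma loopClass_const (f : (under (aut M)).PtSimplex 1 α)
    (hf : ptSimplexVal f = degenerateVertex α ⦋1⦌) : loopClass f = 1 :=
  (translate_map α (𝟙 _) _ (autAtVertex_degenerateAut α ⦋1⦌) _ ((grp_map_id _ _).trans hf.symm)
    (autAtVertex_ptSimplexVal f) 0 1).trans (centralToBar_translate_degenerateAut α ⦋1⦌ _ _)

/-- The fundamental groups of the automorphism complex are isomorphic to the center. -/
noncomputable def piOneAutEquiv (α : (under (aut M)) _⦋0⦌) :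
    HomotopyGroupIso (under (aut M)) 0 α (Center M) where
  toEquiv := Equiv.ofBijective (Quot.lift loopClass (by
      intro f g hr
      obtain ⟨s, h₁, h₂, h₀⟩ := (nonempty_relStruct_iff f g).1 hr
      obtain ⟨c, hc⟩ := exists_ptSimplex (X := under (aut M)) (x := α) (n := 0)
        (degenerateVertex α ⦋1⦌) fun i => map_degenerateVertex _
      -- A homotopy from `f` to `g` is a product triangle whose face 0 is the constant loop `c`.
      have := loopClass_mul g c f s ((h₀ 0 (by decide)).trans hc.symm) h₁ h₂
      rw [this, loopClass_const c hc, mul_one]))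
    ⟨by
      -- Loops with the same element are equal as simplices, not merely homotopic.
      rintro ⟨f⟩ ⟨g⟩ h
      exact congrArg _ (loopClass_injective h), fun z => by
      obtain ⟨f, hf⟩ := loopClass_surjective (α := α) z
      exact ⟨Quot.mk _ f, hf⟩⟩
  map_mul := by
    rintro f g h ⟨r⟩
    refine loopClass_mul f g h (SSet.yonedaEquiv r.map) ?_ ?_ ?_
    · exact (yonedaEquiv_δ_comp (X := under (aut M)) 0 r.map).symm.trans
        (congrArg _ r.δ_castSucc_castSucc_map)
    · exact (yonedaEquiv_δ_comp (X := under (aut M)) 1 r.map).symm.trans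
        (congrArg _ r.δ_succ_castSucc_map)
    · exact (yonedaEquiv_δ_comp (X := under (aut M)) 2 r.map).symm.trans
        (congrArg _ r.δ_succ_succ_map)

/-- As `2 ≤ n`, every edge lies in the boundary and is degenerate at α; edges determine the simplex.
-/
lemma ptSimplex_aut_eq {n : ℕ} (hn : 2 ≤ n) (f : (under (aut M)).PtSimplex n α) :
    ptSimplexVal f = degenerateVertex α ⦋n⦌ := by
  refine aut_ext_of_edges (M := M) (n := ⦋n⦌) fun i j hij => ?_
  exact (map_ptSimplexVal f (by omega) (SimplexCategory.mkOfLe i j hij)).trans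
    (map_degenerateVertex _).symm

lemma subsingleton_homotopyClasses_aut {n : ℕ} (hn : 2 ≤ n) :
    Subsingleton (homotopyClasses (under (aut M)) n α) := by
  constructor
  rintro ⟨f⟩ ⟨g⟩
  exact congrArg _ (ptSimplexVal_injective
    ((ptSimplex_aut_eq hn f).trans (ptSimplex_aut_eq hn g).symm))

end HomotopyGroupsOfAut

/-! ### Higher homotopy classes under an injection that detects simplices by their faces -/

section RelativeHomotopy

variable {X Y : SSet.{u}} (w : X ⟶ Y)

lemma app_degenerateVertex (x : X _⦋0⦌) (n : SimplexCategory) :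
    w.app _ (degenerateVertex x n) = degenerateVertex (w.app _ x) n := app_map w _ x

lemma ptSimplexVal_map {n : ℕ} {x : X _⦋0⦌} (f : X.PtSimplex n x) :
    ptSimplexVal (PtSimplex.map w f) = w.app _ (ptSimplexVal f) :=
  SSet.yonedaEquiv_comp _ _

variable {w}

lemma exists_ptSimplex_map (hw : ∀ n, Function.Injective (w.app n)) {n : ℕ} {x : X _⦋0⦌}
    (g : Y.PtSimplex (n + 1) (w.app _ x)) (t : X _⦋n + 1⦌) (ht : w.app _ t = ptSimplexVal g) :
    ∃ f : X.PtSimplex (n + 1) x, PtSimplex.map w f = g := by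
  obtain ⟨f, rfl⟩ := exists_ptSimplex (x := x) t fun i => hw _ (by
    rw [app_map, ht, δ_ptSimplexVal, app_degenerateVertex])
  exact ⟨f, ptSimplexVal_injective ((ptSimplexVal_map w f).trans ht)⟩

/-- An injective map `w`, such that each simplex of dimension at least `2` whose faces are in the
image of `w` is itself in the image, is bijective on `π_n` for `n ≥ 2`. -/
lemma bijective_homotopyClasses_map (hw : ∀ n, Function.Injective (w.app n))
    (h : ∀ (m : ℕ), 1 ≤ m → ∀ y : Y _⦋m + 1⦌,
      (∀ i, ∃ t, w.app _ t = Y.map (SimplexCategory.δ i).op y) → ∃ t, w.app _ t = y)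
    (n : ℕ) (hn : 1 ≤ n) (x : X _⦋0⦌) :
    Function.Bijective (homotopyClasses.map w (n + 1) x) := by
  have hb : Function.Bijective (PtSimplex.map w : X.PtSimplex (n + 1) x → _) := by
    constructor
    · intro f g hfg
      refine ptSimplexVal_injective (hw _ ?_)
      rw [← ptSimplexVal_map, ← ptSimplexVal_map, hfg]
    · intro g
      obtain ⟨t, ht⟩ := h n hn (ptSimplexVal g) fun i =>
        ⟨degenerateVertex x _, by rw [app_degenerateVertex, δ_ptSimplexVal]⟩
      exact exists_ptSimplex_map hw g t ht
  refine (Quot.congr (Equiv.ofBijective _ hb) fun f g => ⟨?_, ?_⟩).bijective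
  · rintro hr
    obtain ⟨s, h₁, h₂, h₃⟩ := (nonempty_relStruct_iff f g).1 hr
    refine (nonempty_relStruct_iff _ _).2 ⟨w.app _ s, ?_, ?_, fun j hj => ?_⟩
    · rw [← app_map, h₁]; exact (ptSimplexVal_map w f).symm
    · rw [← app_map, h₂]; exact (ptSimplexVal_map w g).symm
    · rw [← app_map, h₃ j hj, app_degenerateVertex]
  · rintro hr
    obtain ⟨s, h₁, h₂, h₃⟩ := (nonempty_relStruct_iff _ _).1 hr
    replace h₁ := h₁.trans (ptSimplexVal_map w f)
    replace h₂ := h₂.trans (ptSimplexVal_map w g)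
    -- Every face of the witness is constant or one of the two given simplices, so all faces lie in
    -- the image and the witness lifts.
    obtain ⟨t, rfl⟩ := h (n + 1) (by omega) s fun i => by
      by_cases hi : i < (Fin.last (n + 1)).castSucc
      · exact ⟨degenerateVertex x _, by rw [app_degenerateVertex, h₃ i hi]⟩
      · by_cases hi' : i = (Fin.last (n + 1)).castSucc
        · exact ⟨_, by rw [hi']; exact h₁.symm⟩
        · have : i = Fin.last (n + 2) := by
            have h1 : i.val < n + 3 := i.2
            have h2 : i.val ≠ n + 1 := fun e => hi' (Fin.ext e)
            simp only [Fin.lt_def, Fin.val_castSucc, Fin.val_last] at hi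
            exact Fin.ext (by rw [Fin.val_last]; omega)
          exact ⟨_, by rw [this]; exact h₂.symm⟩
    refine (nonempty_relStruct_iff _ _).2 ⟨t, hw _ ?_, hw _ ?_, fun j hj => hw _ ?_⟩
    · rw [app_map, h₁]
    · rw [app_map, h₂]
    · rw [app_map, h₃ j hj, app_degenerateVertex]

end RelativeHomotopy

/-! ### Low-dimensional simplices of bar constructions -/

section BarConstruction

/-- The simplex of the bar construction with edges `(v i)⁻¹ * v j`. -/
def BarSimplex.ofVertices {G : Type u} [Group G] {n : ℕ} (v : Fin (n + 1) → G) :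
    BarSimplex G n :=
  ⟨fun i j => (v i)⁻¹ * v j, fun i j k => by group⟩

lemma BarSimplex.ext_one {G : Type u} [Group G] {c d : BarSimplex G 1}
    (h : c.toFun 0 1 = d.toFun 0 1) : c = d := by
  apply BarSimplex.spineEquiv.injective
  funext i
  have : i = 0 := Subsingleton.elim _ _
  subst this
  exact h

lemma BarSimplex.mem_of_one {G : Type u} [Group G] (K : Subgroup G) {c : BarSimplex G 1}
    (h : c.toFun 0 1 ∈ K) (i j : Fin 2) : c.toFun i j ∈ K := by
  have h10 : c.toFun 1 0 = (c.toFun 0 1)⁻¹ :=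
    eq_inv_of_mul_eq_one_left ((c.cocycle 1 0 1).trans (c.self 1))
  fin_cases i <;> fin_cases j
  · exact (c.self 0).symm ▸ K.one_mem
  · exact h
  · exact h10.symm ▸ K.inv_mem h
  · exact (c.self 1).symm ▸ K.one_mem

lemma bar_vertex_eq {G : SimplicialObject GrpCat.{u}} (x y : (bar G) _⦋0⦌) : x = y :=
  BarSimplex.ext fun i j => by
    have hi : i = j := Subsingleton.elim (α := Fin 1) _ _
    subst hi
    exact (BarSimplex.self x i).trans (BarSimplex.self y i).symm

lemma degenerateVertex_bar {G : SimplicialObject GrpCat.{u}} (x : (bar G) _⦋0⦌)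
    (n : SimplexCategory) (i j : Fin (n.len + 1)) :
    BarSimplex.toFun (degenerateVertex x n) i j = 1 :=
  (congrArg (G.map (SimplexCategory.const n ⦋0⦌ 0).op) (BarSimplex.self x (0 : Fin 1))).trans
    (map_one _)

/-- `B² A` is simply connected. -/
lemma nonempty_relStruct_bar_barGroup (A : Type u) [CommGroup A]
    (x : (bar (barGroup A)) _⦋0⦌) (f g : (bar (barGroup A)).PtSimplex 1 x) :
    Nonempty (f.RelStruct g (Fin.last 1)) := by
  let a (h : (bar (barGroup A)).PtSimplex 1 x) : A :=
    BarSimplex.toFun (BarSimplex.toFun (ptSimplexVal h) 0 1 : BarSimplex A 1) 0 1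
  -- `b h` is the triangle `[a h | 1]`: its edges 01 and 02 are both `a h` and its edge 12 is
  -- trivial. On the diagonal a face operator acts in both directions at once, so putting `b g` on
  -- 01 and `b f` on 02 yields faces `g`, `f` and a trivial face 0.
  let b (h : (bar (barGroup A)).PtSimplex 1 x) : BarSimplex A 2 :=
    BarSimplex.ofVertices ![1, a h, a h]
  have hb : ∀ h, (1⁻¹ * b h).toFun 0 1 = a h ∧ (1⁻¹ * b h).toFun 0 2 = a h ∧
      (b h).toFun 1 2 = 1 := by
    intro h
    rw [inv_one, one_mul]
    simp [b, BarSimplex.ofVertices]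
  refine (nonempty_relStruct_iff f g).2
    ⟨(BarSimplex.ofVertices ![1, b g, b f] : BarSimplex (BarSimplex A 2) 2), ?_, ?_, ?_⟩
  · refine BarSimplex.ext_one (BarSimplex.ext_one ?_)
    exact (hb f).2.1
  · refine BarSimplex.ext_one (BarSimplex.ext_one ?_)
    exact (hb g).1
  · intro j hj
    have : j = 0 := by
      have : j.val < 1 := hj
      exact Fin.ext (by simpa using this)
    subst this
    refine BarSimplex.ext_one (BarSimplex.ext_one ?_)
    rw [degenerateVertex_bar]
    change ((b g).toFun 1 2)⁻¹ * (b f).toFun 1 2 = 1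
    rw [(hb f).2.2, (hb g).2.2, inv_one, one_mul]

end BarConstruction

/-! ### The comparison of B²Z(M) with the fibre of B aut(M) over B Out(M) -/

section FibrationSequence

variable {M : SSet.{u}} [IsPartialGroup M]

lemma outProj_surjective (n : SimplexCategoryᵒᵖ) :
    Function.Surjective ((outProj M).app n) := by
  intro a
  obtain ⟨a, rfl⟩ := QuotientGroup.mk_surjective a
  exact ⟨degenerateAut ((autZeroEquiv M).symm a) n.unop,
    congrArg QuotientGroup.mk ((autZeroEquiv M).apply_symm_apply a)⟩

lemma outProj_apply {n : SimplexCategory} (g : (aut M).obj (op n)) :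
    (outProj M).app (op n) g = (QuotientGroup.mk (autAtVertex M 0 g) : Out M) := rfl

lemma outProj_centerHom {n : SimplexCategoryᵒᵖ} (c : (barGroup (Center M)).obj n) :
    (outProj M).app n ((centerHom M).app n c) = 1 := by
  refine (outProj_apply (n := n.unop) _).trans ?_
  rw [mem_centralSimplices.1 (centerHom_mem n.unop c) 0]
  rfl

/-- The fibre is the bar construction of the kernel of q. -/
lemma mem_fiber_iff {n : SimplexCategory} (y : (bar (aut M)).obj (op n)) :
    y ∈ ((SSet.Subcomplex.ofSimplex (bar.vertex (constGroup (Out M)))).preimage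
      (bar.map (outProj M))).obj (op n) ↔
    ∀ i j, (outProj M).app _ (BarSimplex.toFun y i j) = 1 := by
  rw [SSet.Subcomplex.preimage_obj, Set.mem_preimage, SSet.Subcomplex.mem_ofSimplex_obj_iff]
  constructor
  · rintro ⟨f, hf⟩ i j
    exact congr(BarSimplex.toFun $hf i j).symm
  · intro h
    exact ⟨SimplexCategory.const n ⦋0⦌ 0, BarSimplex.ext fun i j => (h i j).symm⟩

variable (M) in
/-- The comparison map from `B² Z(M)` to the fibre of `B aut(M) ⟶ B Out(M)`. -/
noncomputable def toFiber : bar (barGroup (Center M)) ⟶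
    fiber (bar.map (outProj M)) (bar.vertex (constGroup (Out M))) :=
  SSet.Subcomplex.lift (bar.map (centerHom M)) (by
    rintro ⟨n⟩ _ ⟨c, rfl⟩
    exact (mem_fiber_iff _).2 fun i j => outProj_centerHom _)

lemma toFiber_injective (n : SimplexCategoryᵒᵖ) : Function.Injective ((toFiber M).app n) := by
  intro c d h
  refine BarSimplex.ext fun i j => centerHom_injective n ?_
  exact congr(BarSimplex.toFun (Subtype.val $h) i j)

/-- Since j identifies BZ(M) with the central simplices, membership in the image becomes a condition
on the vertices of each group element. -/
lemma exists_toFiber_eq_iff {n : SimplexCategory}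
    (y : (fiber (bar.map (outProj M)) (bar.vertex (constGroup (Out M)))).obj (op n)) :
    (∃ c, (toFiber M).app _ c = y) ↔
      ∀ i j, BarSimplex.toFun y.1 i j ∈ centralSimplices M n := by
  constructor
  · rintro ⟨c, rfl⟩ i j
    exact centerHom_mem n _
  · intro h
    refine ⟨(⟨fun i j => centralEquiv M n ⟨_, h i j⟩, fun i j k => ?_⟩ :
      BarSimplex (BarSimplex (Center M) n.len) n.len), Subtype.ext (BarSimplex.ext fun i j => ?_)⟩
    · rw [← map_mul]
      exact congrArg _ (Subtype.ext (BarSimplex.cocycle y.1 i j k))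
    · exact centerHom_centralEquiv n _

/-- If some vertex `k` differs from `i`, `j` and `v`, the vertex `v` of the element `y i j` is
visible on the face `k`. In dimension 2 the three indices may leave no such `k`, so the element is
split as `y i v * y v j`: each factor involves at most two of the at least three vertices. -/
lemma exists_toFiber_of_faces (m : ℕ) (hm : 1 ≤ m)
    (y : (fiber (bar.map (outProj M)) (bar.vertex (constGroup (Out M)))) _⦋m + 1⦌)
    (hy : ∀ i, ∃ c, (toFiber M).app _ c = (fiber (bar.map (outProj M))
      (bar.vertex (constGroup (Out M)))).map (SimplexCategory.δ i).op y) :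
    ∃ c, (toFiber M).app _ c = y := by
  refine (exists_toFiber_eq_iff y).2 fun i j => mem_centralSimplices.2 fun v => ?_
  change Fin (m + 2) at i j v
  have key : ∀ (i j v k : Fin (m + 2)), i ≠ k → j ≠ k → v ≠ k →
      autAtVertex M (n := ⦋m + 1⦌) v (BarSimplex.toFun y.1 i j) = 1 := by
    intro i j v k hi hj hv
    obtain ⟨i, rfl⟩ := Fin.exists_succAbove_eq hi
    obtain ⟨j, rfl⟩ := Fin.exists_succAbove_eq hj
    obtain ⟨v, rfl⟩ := Fin.exists_succAbove_eq hv
    exact mem_centralSimplices.1 ((exists_toFiber_eq_iff _).1 (hy k) i j) v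
  obtain ⟨k, hki, hkv⟩ := Fin.exists_ne_and_ne_of_two_lt i v (by omega)
  obtain ⟨l, hlv, hlj⟩ := Fin.exists_ne_and_ne_of_two_lt v j (by omega)
  have h := BarSimplex.cocycle y.1 i v j
  rw [← h, map_mul, key i v v k hki.symm hkv.symm hkv.symm,
    key v j v l hlv.symm hlj.symm hlv.symm, mul_one]

lemma map_const_eq_one {n : SimplexCategory} {X : SSet.{u}} (g : (aut X).obj (op n))
    (i : Fin (n.len + 1)) (h : autAtVertex X i g = 1) (m : SimplexCategory) :
    (aut X).map (SimplexCategory.const m n i).op g = 1 := by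
  have : (aut X).map (SimplexCategory.const ⦋0⦌ n i).op g = 1 :=
    (autZeroEquiv X).injective (h.trans (map_one _).symm)
  rw [show SimplexCategory.const m n i = SimplexCategory.const m ⦋0⦌ 0 ≫
    SimplexCategory.const ⦋0⦌ n i from rfl, ← grp_map_map, this, map_one]

lemma exists_aut_edge_of_mem_Inn {φ ψ : Aut M} (hφ : φ ∈ Inn M) (hψ : ψ ∈ Inn M) :
    ∃ g : (aut M).obj (op ⦋1⦌), autAtVertex M (n := ⦋1⦌) 0 g = φ ∧
      autAtVertex M (n := ⦋1⦌) 1 g = ψ :=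
  exists_aut_edge φ ψ ((Out.mk_eq_mk_iff _ _).1
    (((QuotientGroup.eq_one_iff φ).2 hφ).trans ((QuotientGroup.eq_one_iff ψ).2 hψ).symm))

/-- With ψ the end of γ and ε a path from 1 to ψ⁻¹, multiply two degenerate triangles: γ extended
constantly at its end, and ε preceded by a constant edge at 1. Only the last vertex is altered, from
ψ to 1. -/
lemma exists_simplex_to_one (γ : (aut M).obj (op ⦋1⦌))
    (h : autAtVertex M (n := ⦋1⦌) 1 γ ∈ Inn M) : ∃ a : (aut M).obj (op ⦋2⦌),
      (aut M).map (SimplexCategory.δ 2).op a = γ ∧ autAtVertex M (n := ⦋2⦌) 2 a = 1 := by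
  obtain ⟨ε, hε₀, hε₁⟩ := exists_aut_edge_of_mem_Inn (one_mem _) (inv_mem h)
  refine ⟨(aut M).map (SimplexCategory.σ 1).op γ * (aut M).map (SimplexCategory.σ 0).op ε, ?_, ?_⟩
  · rw [map_mul, grp_map_map, grp_map_map,
      show SimplexCategory.δ (2 : Fin 3) ≫ SimplexCategory.σ (1 : Fin 2) = 𝟙 ⦋1⦌ by decide,
      show SimplexCategory.δ (2 : Fin 3) ≫ SimplexCategory.σ (0 : Fin 2) =
        SimplexCategory.const ⦋1⦌ ⦋1⦌ 0 by decide, map_const_eq_one ε (0 : Fin 2) hε₀, grp_map_id,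
      mul_one]
  · rw [map_mul, autAtVertex_map, autAtVertex_map,
      show (SimplexCategory.σ (1 : Fin 2)).toOrderHom 2 = (1 : Fin 2) by decide,
      show (SimplexCategory.σ (0 : Fin 2)).toOrderHom 2 = (1 : Fin 2) by decide]
    exact (congrArg _ hε₁).trans (mul_inv_cancel _)

/-- A path from φ⁻¹ to 1, extended constantly at its end. It cancels the initial vertex of an edge
in `exists_deformation`. -/
lemma exists_simplex_from_inv {φ : Aut M} (h : φ ∈ Inn M) : ∃ b : (aut M).obj (op ⦋2⦌),
      (aut M).map (SimplexCategory.δ 0).op b = 1 ∧ autAtVertex M (n := ⦋2⦌) 0 b = φ⁻¹ ∧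
      autAtVertex M (n := ⦋2⦌) 2 b = 1 := by
  obtain ⟨ζ, hζ₀, hζ₁⟩ := exists_aut_edge_of_mem_Inn (inv_mem h) (one_mem _)
  refine ⟨(aut M).map (SimplexCategory.σ 1).op ζ, ?_, ?_, ?_⟩
  · rw [grp_map_map, show SimplexCategory.δ (0 : Fin 3) ≫ SimplexCategory.σ (1 : Fin 2) =
        SimplexCategory.const ⦋1⦌ ⦋1⦌ 1 by decide, map_const_eq_one ζ (1 : Fin 2) hζ₁]
  · rw [autAtVertex_map, show (SimplexCategory.σ (1 : Fin 2)).toOrderHom 0 = (0 : Fin 2) by decide]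
    exact hζ₀
  · rw [autAtVertex_map, show (SimplexCategory.σ (1 : Fin 2)).toOrderHom 2 = (1 : Fin 2) by decide]
    exact hζ₁

lemma outProj_eq_one {n : SimplexCategory} {g : (aut M).obj (op n)}
    (h : autAtVertex M 0 g ∈ Inn M) : (outProj M).app (op n) g = 1 :=
  (outProj_apply g).trans ((QuotientGroup.eq_one_iff _).2 h)

/-- The triangle `[a | b]`. -/
def barTriangle {G : Type u} [Group G] (a b : G) : BarSimplex G 2 :=
  BarSimplex.ofVertices ![1, a, a * b]

lemma barTriangle_zero_one {G : Type u} [Group G] (a b : G) : (barTriangle a b).toFun 0 1 = a := by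
  simp [barTriangle, BarSimplex.ofVertices]

lemma barTriangle_zero_two {G : Type u} [Group G] (a b : G) :
    (barTriangle a b).toFun 0 2 = a * b := by
  simp [barTriangle, BarSimplex.ofVertices]

lemma barTriangle_one_two {G : Type u} [Group G] (a b : G) : (barTriangle a b).toFun 1 2 = b := by
  simp [barTriangle, BarSimplex.ofVertices]

lemma barTriangle_mem {G : Type u} [Group G] (K : Subgroup G) {a b : G} (ha : a ∈ K) (hb : b ∈ K)
    (i j : Fin 3) : (barTriangle a b).toFun i j ∈ K := by
  have : ∀ i : Fin 3, (![1, a, a * b] : Fin 3 → G) i ∈ K := by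
    intro i
    fin_cases i
    · exact K.one_mem
    · exact ha
    · exact K.mul_mem ha hb
  exact K.mul_mem (K.inv_mem (this i)) (this j)

/-- Each edge of the fibre can be deformed to an edge in the image of `B² Z(M)`. -/
lemma exists_deformation
    (y : (fiber (bar.map (outProj M)) (bar.vertex (constGroup (Out M)))) _⦋1⦌) :
    ∃ s : (fiber (bar.map (outProj M)) (bar.vertex (constGroup (Out M)))) _⦋2⦌,
      (fiber (bar.map (outProj M)) _).map (SimplexCategory.δ 2).op s = y ∧
      (∀ i j, BarSimplex.toFun ((fiber (bar.map (outProj M)) _).map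
        (SimplexCategory.δ 0).op s).1 i j = 1) ∧
      ∃ c, (toFiber M).app _ c = (fiber (bar.map (outProj M)) _).map (SimplexCategory.δ 1).op s := by
  obtain ⟨γ, hγ⟩ : ∃ γ : (aut M).obj (op ⦋1⦌), γ = BarSimplex.toFun y.1 (0 : Fin 2) (1 : Fin 2) :=
    ⟨_, rfl⟩
  have hy : (outProj M).app (op ⦋1⦌) γ = 1 := hγ ▸ (mem_fiber_iff y.1).1 y.2 (0 : Fin 2) (1 : Fin 2)
  have h₀ : autAtVertex M (n := ⦋1⦌) 0 γ ∈ Inn M := (QuotientGroup.eq_one_iff _).1 hy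
  have h₁ : autAtVertex M (n := ⦋1⦌) 1 γ ∈ Inn M :=
    (QuotientGroup.eq_one_iff _).1
      (((Out.mk_eq_mk_iff _ _).2 (homotopy_of_aut_edge γ)).symm.trans hy)
  -- In the triangle `[a | b]` the face 2 is γ and the face 0 is trivial. The product `a * b` is the
  -- identity at the vertices 0 and 2, which are the ones that the face 1 retains, so that face is
  -- central.
  obtain ⟨a, fa, a2⟩ := exists_simplex_to_one γ h₁
  obtain ⟨b, fb, b0, b2⟩ := exists_simplex_from_inv h₀
  have a0 : autAtVertex M (n := ⦋2⦌) 0 a = autAtVertex M (n := ⦋1⦌) 0 γ := by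
    rw [← fa]
    rfl
  have qa : a ∈ ((outProj M).app (op ⦋2⦌)).hom.ker := outProj_eq_one (n := ⦋2⦌) (a0.symm ▸ h₀)
  have qb : b ∈ ((outProj M).app (op ⦋2⦌)).hom.ker :=
    outProj_eq_one (n := ⦋2⦌) (b0.symm ▸ inv_mem h₀)
  have hab : (aut M).map (SimplexCategory.δ 1).op (a * b) ∈ centralSimplices M ⦋1⦌ := by
    refine mem_centralSimplices.2 fun v => ?_
    rw [autAtVertex_map, map_mul]
    change Fin 2 at v
    have : v = 0 ∨ v = 1 := by fin_cases v <;> simp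
    rcases this with rfl | rfl
    · rw [show (SimplexCategory.δ (1 : Fin 3)).toOrderHom (0 : Fin 2) = (0 : Fin 3) by decide]
      exact (congrArg₂ _ a0 b0).trans (mul_inv_cancel _)
    · rw [show (SimplexCategory.δ (1 : Fin 3)).toOrderHom (1 : Fin 2) = (2 : Fin 3) by decide]
      exact (congrArg₂ _ a2 b2).trans (mul_one _)
  refine ⟨⟨barTriangle a b, (mem_fiber_iff (n := ⦋2⦌) _).2 (barTriangle_mem _ qa qb)⟩, ?_, ?_, ?_⟩
  · refine Subtype.ext (BarSimplex.ext_one ?_)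
    refine Eq.trans ?_ hγ
    refine Eq.trans ?_ fa
    exact congrArg ((aut M).map (SimplexCategory.δ 2).op) (barTriangle_zero_one a b)
  · refine fun i j => Subgroup.mem_bot.1 (BarSimplex.mem_of_one ⊥ (Subgroup.mem_bot.2 ?_) i j)
    refine Eq.trans ?_ fb
    exact congrArg ((aut M).map (SimplexCategory.δ 0).op) (barTriangle_one_two a b)
  · refine (exists_toFiber_eq_iff _).2 (BarSimplex.mem_of_one (centralSimplices M ⦋1⦌) ?_)
    rw [← barTriangle_zero_two a b] at hab
    exact hab

lemma fiber_vertex_eq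
    (y z : (fiber (bar.map (outProj M)) (bar.vertex (constGroup (Out M)))) _⦋0⦌) : y = z :=
  Subtype.ext (bar_vertex_eq _ _)

/-- Both sides have a single vertex. On π₁ the source is trivial and `exists_deformation` gives
surjectivity; above that, the image is detected by faces. -/
lemma isWeakEquivalence_toFiber : IsWeakEquivalence (toFiber M) where
  bijective_π₀ := by
    constructor
    · intro a b _
      induction a with | mk a
      induction b with | mk b
      rw [bar_vertex_eq a b]
    · intro b
      induction b with | mk b
      exact ⟨SSet.π₀.mk (bar.vertex _), congrArg SSet.π₀.mk (fiber_vertex_eq _ _)⟩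
  bijective_π n hn x := by
    obtain ⟨n, rfl⟩ := Nat.exists_eq_add_of_le' hn
    obtain _ | n := n
    · constructor
      · rintro ⟨f⟩ ⟨g⟩ _
        exact Quot.sound (nonempty_relStruct_bar_barGroup _ x f g)
      · rintro ⟨g⟩
        obtain ⟨s, h₂, h₀, c, hc⟩ := exists_deformation (ptSimplexVal g)
        obtain ⟨f, hf⟩ := exists_ptSimplex (n := 0) (x := x) c fun i => bar_vertex_eq _ _
        refine ⟨Quot.mk _ f, Quot.sound ((nonempty_relStruct_iff _ _).2 ⟨s, ?_, h₂, ?_⟩)⟩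
        · exact hc.symm.trans ((congrArg _ hf.symm).trans (ptSimplexVal_map (toFiber M) f).symm)
        · intro j hj
          have : j = 0 := by
            have : j.val < 1 := hj
            exact Fin.ext (by simpa using this)
          subst this
          refine Subtype.ext (BarSimplex.ext fun i k => (h₀ i k).trans ?_)
          exact (degenerateVertex_bar (Subtype.val _) _ i k).symm
    · exact bijective_homotopyClasses_map toFiber_injective exists_toFiber_of_faces (n + 1)
        (by omega) x

variable (M) in
lemma isFibrationSequence_center : IsFibrationSequence (bar.map (centerHom M))
    (bar.map (outProj M)) (bar.vertex (constGroup (Out M))) where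
  kanComplex_fibre := kanComplex_bar _
  kanComplex_base := kanComplex_bar _
  fibration := rlp_horns_bar_map _ outProj_surjective
  exists_weakEquivalence := ⟨toFiber M, SSet.Subcomplex.lift_ι _ _, isWeakEquivalence_toFiber⟩

end FibrationSequence

end PGrp

open PGrp
theorem corollary3p3 (M : SSet.{u}) [IsPartialGroup M] :
    (∃ j : barGroup (Center M) ⟶ aut M,
      (∀ c : BarSimplex (Center M) 1,
        evalUnit ((j.app (op ⦋1⦌)).hom c).val = (c.toFun 0 1).val) ∧
      IsFibrationSequence (bar.map j) (bar.map (outProj M)) (bar.vertex (constGroup (Out M)))) ∧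
    SSet.KanComplex (under (aut M)) ∧
    (∃ e : PiZero (aut M) ≃* Out M, ∀ a : (aut M).obj (op ⦋0⦌),
      e (PiZero.mk a) = QuotientGroup.mk (autZeroEquiv M a)) ∧
    ∀ α : (under (aut M)) _⦋0⦌,
      Nonempty (HomotopyGroupIso (under (aut M)) 0 α (Center M)) ∧
      ∀ n : ℕ, 2 ≤ n → Subsingleton (homotopyClasses (under (aut M)) n α) :=
  ⟨⟨centerHom M, evalUnit_centerHom, isFibrationSequence_center M⟩, kanComplex_under _,
    ⟨piZeroAutEquiv M, fun _ => rfl⟩,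
    fun α => ⟨⟨piOneAutEquiv α⟩, fun _ => subsingleton_homotopyClasses_aut⟩⟩
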